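/- **Theorem.** Let $\kappa>0$ and let $\gamma:\mathbb R\to\mathbb R^2$ be a real-analytic, $2\pi$-periodic map with $\gamma'(t)\neq 0$ for all $t$ (for instance, a parametrization of the analytic boundary curve of a bounded domain); put $n=(\gamma_2',-\gamma_1')$. For $s\in\mathbb R$ let $H^s=H^s[0,2\pi]$ be the space of $2\pi$-periodic distributions $u$ with $$\|u\|_s^2=\sum_{m\in\mathbb Z}(1+m^2)^s|\hat u_m|^2<\infty ,\qquad \hat u_m=\frac1{2\pi}\int_0^{2\pi}u(t)e^{-\mathrm imt}\,\mathrm dt .$$ Define $$(S_0\phi)(t)=-\frac1{2\pi}\int_0^{2\pi}\ln\Big(4\sin^2\frac{t-\zeta}2\Big)\phi(\zeta)\,\mathrm d\zeta+\frac{\mathrm i}{2\pi}\int_0^{2\pi}\phi(\zeta)\,\mathrm d\zeta,$$ $$(S_1\phi)(t)=\frac1{4\pi}\int_0^{2\pi}\ln\Big(4\sin^2\frac{t-\zeta}2\Big)\sin(t-\zeta)\,\phi(\zeta)\,\mathrm d\zeta,$$ $$(S_2\phi)(t)=-\frac1{8\pi}\int_0^{2\pi}\ln\Big(4\sin^2\frac{t-\zeta}2\Big)\sin^2(t-\zeta)\,\phi(\zeta)\,\mathrm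 d\zeta,$$ $$(T_0\phi)(t)=\frac1{2\pi}\,\mathrm{p.v.}\!\int_0^{2\pi}\cot\Big(\frac{\zeta-t}2\Big)\phi'(\zeta)\,\mathrm d\zeta+\frac{\mathrm i}{2\pi}\int_0^{2\pi}\phi(\zeta)\,\mathrm d\zeta$$ for smooth periodic $\phi$, and extend these operators to periodic distributions by duality. Let $E_1,E_2,E_3,E_6$ be the operators of multiplication by $\kappa^2|\gamma'|^2$, $\kappa^2\, n\cdot\gamma''$, $\kappa^2\,\gamma'\cdot\gamma''$ and $\frac74\kappa^4|\gamma'|^4+\kappa^2\,\gamma'\cdot\gamma'''$, respectively. On pairs of periodic distributions put $$\mathcal N=\begin{pmatrix} I+E_2S_2 & S_0+E_1S_2\\ T_0+\frac12E_1S_0+E_3S_1+E_6S_2 & -I-E_2S_2\end{pmatrix},$$ $$\mathcal U=\begin{pmatrix} I+S_0T_0+E_1S_0S_0&0\\0&I+T_0S_0+E_1S_0S_0\end{pmatrix}.$$ Then for every real $p\ge0$ the operator $\mathcal U$ is an isomorphism (a linear homeomorphism) from $H^p\times H^p$ onto $H^{p+2}\times H^{p+2}$, and there is a compact linear operator $\mathcal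 J:H^p\times H^p\to H^{p+2}\times H^{p+2}$ such that $$\mathcal N^2\psi=(\mathcal U+\mathcal J)\psi\qquad\text{for all }\psi\in H^p\times H^p .$$ In particular, $\mathcal N^2$ maps $H^p\times H^p$ into $H^{p+2}\times H^{p+2}$. -/

import Mathlib

open scoped ContDiff Real Topology

noncomputable section

namespace Biharmonic

/-! ## Periodic test functions -/

/-- The smooth `2π`-periodic functions `ℝ → ℂ`, as a subspace of all functions. -/
def testSubmodule : Submodule ℂ (ℝ → ℂ) where
  carrier := {φ | ContDiff ℝ ∞ φ ∧ Function.Periodic φ (2 * π)}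
  add_mem' := fun ha hb => ⟨ha.1.add hb.1, ha.2.add hb.2⟩
  zero_mem' := ⟨contDiff_const, fun _ => rfl⟩
  smul_mem' := fun c _ ha => ⟨ha.1.const_smul c, ha.2.smul c⟩

/-- The space `C^∞` of smooth `2π`-periodic functions (the test functions). -/
def Test : Type := testSubmodule

instance : AddCommGroup Test := inferInstanceAs (AddCommGroup testSubmodule)
instance : Module ℂ Test := inferInstanceAs (Module ℂ testSubmodule)

instance : FunLike Test ℝ ℂ where
  coe φ := φ.1
  coe_injective _ _ h := Subtype.ext h

/-- Bundle a smooth periodic function as a test function. -/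
def Test.mk (f : ℝ → ℂ) (hf : ContDiff ℝ ∞ f) (hp : Function.Periodic f (2 * π)) : Test :=
  ⟨f, hf, hp⟩

@[simp] theorem Test.mk_apply (f : ℝ → ℂ) (hf hp) (t : ℝ) : Test.mk f hf hp t = f t := rfl
@[simp] theorem Test.add_apply (φ ψ : Test) (t : ℝ) : (φ + ψ) t = φ t + ψ t := rfl
@[simp] theorem Test.smul_apply (c : ℂ) (φ : Test) (t : ℝ) : (c • φ) t = c * φ t := rfl
@[simp] theorem Test.zero_apply (t : ℝ) : (0 : Test) t = 0 := rfl

theorem Test.smooth (φ : Test) : ContDiff ℝ ∞ φ := φ.2.1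
theorem Test.periodic (φ : Test) : Function.Periodic φ (2 * π) := φ.2.2
theorem Test.continuous (φ : Test) : Continuous φ := φ.smooth.continuous

@[ext] theorem Test.ext {φ ψ : Test} (h : ∀ t, φ t = ψ t) : φ = ψ := DFunLike.ext _ _ h

theorem periodic_deriv {E : Type*} [NormedAddCommGroup E] [NormedSpace ℝ E] {f : ℝ → E} {c : ℝ}
    (hp : Function.Periodic f c) : Function.Periodic (deriv f) c := by
  intro t
  have h : (fun x => f (x + c)) = f := funext hp
  rw [← deriv_comp_add_const, h]

theorem contDiff_deriv {E : Type*} [NormedAddCommGroup E] [NormedSpace ℝ E] {f : ℝ → E}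
    (hf : ContDiff ℝ ∞ f) : ContDiff ℝ ∞ (deriv f) :=
  (contDiff_infty_iff_deriv.1 hf).2

theorem Test.differentiable (φ : Test) : Differentiable ℝ φ :=
  (contDiff_infty_iff_deriv.1 φ.smooth).1

/-- The derivative `φ ↦ φ'` on test functions. -/
def D : Test →ₗ[ℂ] Test where
  toFun φ := Test.mk (deriv φ) (contDiff_deriv φ.smooth) (periodic_deriv φ.periodic)
  map_add' φ ψ := by
    ext t
    exact deriv_add (φ.differentiable t) (ψ.differentiable t)
  map_smul' c φ := by
    ext t
    exact deriv_const_mul c (φ.differentiable t)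

theorem D_apply (φ : Test) (t : ℝ) : D φ t = deriv φ t := rfl

theorem Test.hasDerivAt (φ : Test) (t : ℝ) : HasDerivAt φ (D φ t) t :=
  (φ.differentiable t).hasDerivAt

/-- A test function as a bounded continuous function (with the sup norm). -/
def toBCF : Test →ₗ[ℂ] BoundedContinuousFunction ℝ ℂ where
  toFun φ := BoundedContinuousFunction.mkOfBound ⟨φ, φ.continuous⟩
    (Metric.diam (Set.range φ)) fun x y =>
      Metric.dist_le_diam_of_mem
        (φ.periodic.isBounded_of_continuous Real.two_pi_pos.ne' φ.continuous)
        (Set.mem_range_self x) (Set.mem_range_self y)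
  map_add' _ _ := rfl
  map_smul' _ _ := rfl

@[simp] theorem toBCF_apply (φ : Test) (t : ℝ) : toBCF φ t = φ t := rfl

/-- All derivatives of a test function, each as a bounded continuous function. -/
def jet : Test →ₗ[ℂ] (ℕ → BoundedContinuousFunction ℝ ℂ) :=
  LinearMap.pi fun k => toBCF ∘ₗ D ^ k

/-- The usual Fréchet topology of `C^∞`: uniform convergence of every derivative. -/
instance : TopologicalSpace Test := TopologicalSpace.induced jet inferInstance
instance : IsTopologicalAddGroup Test := topologicalAddGroup_induced jet
instance : ContinuousSMul ℂ Test := continuousSMul_induced jet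

theorem continuous_jet : Continuous jet := continuous_induced_dom

theorem continuous_toBCF_pow (k : ℕ) : Continuous fun φ : Test => toBCF ((D ^ k) φ) :=
  (continuous_apply k).comp continuous_jet

theorem continuous_toBCF : Continuous toBCF := continuous_toBCF_pow 0

theorem continuous_test_iff {X : Type*} [TopologicalSpace X] {f : X → Test} :
    Continuous f ↔ ∀ k, Continuous fun x => toBCF ((D ^ k) (f x)) := by
  rw [continuous_induced_rng, continuous_pi_iff]
  rfl

theorem continuous_D : Continuous D :=
  continuous_test_iff.2 fun k => by
    have := continuous_toBCF_pow (k + 1)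
    simpa only [pow_succ, Module.End.mul_apply] using this

theorem continuous_D_pow (n : ℕ) : Continuous fun φ => (D ^ n) φ := by
  induction n with
  | zero => exact continuous_id
  | succ n ih =>
    simp only [pow_succ, Module.End.mul_apply]
    exact ih.comp continuous_D

/-- The derivative as a continuous operator on test functions. -/
def DL : Test →L[ℂ] Test := ⟨D, continuous_D⟩

/-- Multiplication of test functions by the smooth periodic function `a`. -/
def mulTest (a : Test) : Test →ₗ[ℂ] Test where
  toFun φ := Test.mk (fun t => a t * φ t) (a.smooth.mul φ.smooth) (a.periodic.mul φ.periodic)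
  map_add' φ ψ := by ext t; simp [mul_add]
  map_smul' c φ := by ext t; simp; ring

@[simp] theorem mulTest_apply (a φ : Test) (t : ℝ) : mulTest a φ t = a t * φ t := rfl

theorem D_mulTest (a φ : Test) : D (mulTest a φ) = mulTest (D a) φ + mulTest a (D φ) := by
  ext t
  exact ((a.hasDerivAt t).mul (φ.hasDerivAt t)).deriv

theorem continuous_mulTest (a : Test) : Continuous (mulTest a) := by
  refine continuous_test_iff.2 fun k => ?_
  induction k generalizing a with
  | zero => exact (continuous_const (y := toBCF a)).mul continuous_toBCF
  | succ k ih =>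
    simp only [pow_succ, Module.End.mul_apply, D_mulTest, map_add]
    exact (ih _).add ((ih a).comp continuous_D)

/-- Multiplication by `a` as a continuous operator on test functions. -/
def mulTestL (a : Test) : Test →L[ℂ] Test := ⟨mulTest a, continuous_mulTest a⟩

/-! ## Convolution with an integrable periodic kernel -/

/-- An integrable `2π`-periodic convolution kernel. -/
structure Kernel where
  /-- the kernel -/
  toFun : ℝ → ℂ
  periodic : Function.Periodic toFun (2 * π)
  integrable : IntervalIntegrable toFun MeasureTheory.volume 0 (2 * π)

theorem Kernel.intervalIntegrable (k : Kernel) (a b : ℝ) :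
    IntervalIntegrable k.toFun MeasureTheory.volume a b :=
  k.periodic.intervalIntegrable₀ Real.two_pi_pos.ne' k.integrable a b

/-- The reflected kernel `τ ↦ k (-τ)`. -/
def Kernel.reflect (k : Kernel) : Kernel where
  toFun τ := k.toFun (-τ)
  periodic t := by
    have h := k.periodic (-t - 2 * π)
    rw [sub_add_cancel] at h
    simp only [h]; congr 1; ring
  integrable := by
    have h := k.intervalIntegrable 0 (-(2 * π))
    rw [IntervalIntegrable.iff_comp_neg] at h
    simpa using h

/-- The integral operator `(k * φ)(t) = ∫_0^{2π} k(t - ζ) φ(ζ) dζ`. -/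
def Kernel.conv (k : Kernel) (φ : ℝ → ℂ) (t : ℝ) : ℂ :=
  ∫ ζ in (0 : ℝ)..2 * π, k.toFun (t - ζ) * φ ζ

theorem Kernel.conv_eq (k : Kernel) (φ : Test) (t : ℝ) :
    k.conv φ t = ∫ τ in (0 : ℝ)..2 * π, k.toFun τ * φ (t - τ) := by
  have hper : Function.Periodic (fun τ => k.toFun τ * φ (t - τ)) (2 * π) := by
    intro τ
    have := φ.periodic (t - (τ + 2 * π))
    simp only [k.periodic τ]
    rw [← this]; congr 2; ring
  have h1 := intervalIntegral.integral_comp_sub_left (a := 0) (b := 2 * π)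
    (fun τ => k.toFun τ * φ (t - τ)) t
  have h2 := hper.intervalIntegral_add_eq (t - 2 * π) 0
  simp only [sub_sub_cancel, sub_add_cancel, zero_add, sub_zero] at h1 h2
  rw [← h2, ← h1]; rfl

theorem Kernel.hasDerivAt_conv (k : Kernel) (φ : Test) (t : ℝ) :
    HasDerivAt (k.conv φ) (k.conv (D φ) t) t := by
  have e : k.conv φ = fun t => ∫ τ in (0 : ℝ)..2 * π, k.toFun τ * φ (t - τ) :=
    funext (k.conv_eq φ)
  rw [e, k.conv_eq]
  have hk := k.intervalIntegrable 0 (2 * π)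
  have hc : ∀ (ψ : Test) (x : ℝ), Continuous fun τ => ψ (x - τ) := fun ψ x =>
    ψ.continuous.comp (continuous_const.sub continuous_id)
  have hI : ∀ (ψ : Test) (x : ℝ), IntervalIntegrable (fun τ => k.toFun τ * ψ (x - τ))
      MeasureTheory.volume 0 (2 * π) := fun ψ x => hk.mul_continuousOn (hc ψ x).continuousOn
  refine (intervalIntegral.hasDerivAt_integral_of_dominated_loc_of_deriv_le
    (s := Set.univ) (bound := fun τ => ‖k.toFun τ‖ * ‖toBCF (D φ)‖)
    (F' := fun x τ => k.toFun τ * D φ (x - τ)) Filter.univ_mem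
    (Filter.Eventually.of_forall fun x => (hI φ x).aestronglyMeasurable_restrict_uIoc)
    (hI φ t) (hI (D φ) t).aestronglyMeasurable_restrict_uIoc
    (Filter.Eventually.of_forall fun τ _ x _ => ?_) (hk.norm.mul_const _)
    (Filter.Eventually.of_forall fun τ _ x _ => ?_)).2
  · rw [norm_mul]
    exact mul_le_mul_of_nonneg_left ((toBCF (D φ)).norm_coe_le_norm _) (norm_nonneg _)
  · have := ((φ.hasDerivAt (x - τ)).comp_sub_const x τ)
    exact this.const_mul _

theorem Kernel.contDiff_conv (k : Kernel) (φ : Test) : ContDiff ℝ ∞ (k.conv φ) := by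
  rw [contDiff_infty]
  intro n
  induction n generalizing φ with
  | zero =>
    rw [Nat.cast_zero, contDiff_zero]
    exact continuous_iff_continuousAt.2 fun t => (k.hasDerivAt_conv φ t).continuousAt
  | succ n ih =>
    rw [Nat.cast_succ, contDiff_succ_iff_deriv]
    refine ⟨fun t => (k.hasDerivAt_conv φ t).differentiableAt, by simp, ?_⟩
    rw [show deriv (k.conv φ) = k.conv (D φ) from
      funext fun t => (k.hasDerivAt_conv φ t).deriv]
    exact ih (D φ)

theorem Kernel.intervalIntegrable_mul (k : Kernel) (φ : Test) (t : ℝ) :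
    IntervalIntegrable (fun τ => k.toFun τ * φ (t - τ)) MeasureTheory.volume 0 (2 * π) :=
  (k.intervalIntegrable 0 (2 * π)).mul_continuousOn
    (φ.continuous.comp (continuous_const.sub continuous_id)).continuousOn

/-- Convolution with `k` as a linear map on test functions. -/
def Kernel.convTest (k : Kernel) : Test →ₗ[ℂ] Test where
  toFun φ := Test.mk (k.conv φ) (k.contDiff_conv φ) fun t => by
    simp only [k.conv_eq]
    refine intervalIntegral.integral_congr fun τ _ => ?_
    have := φ.periodic (t - τ)
    simp only [← this]; congr 2; ring
  map_add' φ ψ := by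
    ext t
    change k.conv (φ + ψ : Test) t = k.conv φ t + k.conv ψ t
    simp only [k.conv_eq, Test.add_apply, mul_add]
    exact intervalIntegral.integral_add (k.intervalIntegrable_mul φ t)
      (k.intervalIntegrable_mul ψ t)
  map_smul' c φ := by
    ext t
    change k.conv (c • φ : Test) t = c * k.conv φ t
    simp only [k.conv_eq, Test.smul_apply, mul_left_comm _ c]
    exact intervalIntegral.integral_const_mul _ _

theorem Kernel.convTest_apply (k : Kernel) (φ : Test) (t : ℝ) :
    k.convTest φ t = ∫ ζ in (0 : ℝ)..2 * π, k.toFun (t - ζ) * φ ζ := rfl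

theorem Kernel.D_convTest (k : Kernel) (φ : Test) : D (k.convTest φ) = k.convTest (D φ) := by
  ext t
  exact (k.hasDerivAt_conv φ t).deriv

theorem Kernel.continuous_convTest (k : Kernel) : Continuous k.convTest := by
  have h0 : Continuous fun φ => toBCF (k.convTest φ) := by
    set C : ℝ := ∫ τ in (0 : ℝ)..2 * π, ‖k.toFun τ‖ with hC
    have hC0 : 0 ≤ C := intervalIntegral.integral_nonneg Real.two_pi_pos.le fun _ _ => norm_nonneg _
    have hb : ∀ φ, ‖toBCF (k.convTest φ)‖ ≤ C * ‖toBCF φ‖ := by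
      intro φ
      refine (BoundedContinuousFunction.norm_le (by positivity)).2 fun t => ?_
      rw [toBCF_apply]
      change ‖k.conv φ t‖ ≤ _
      rw [k.conv_eq, hC, ← intervalIntegral.integral_mul_const]
      refine intervalIntegral.norm_integral_le_of_norm_le Real.two_pi_pos.le
        (Filter.Eventually.of_forall fun τ _ => ?_)
        ((k.intervalIntegrable 0 (2 * π)).norm.mul_const _)
      rw [norm_mul]
      exact mul_le_mul_of_nonneg_left ((toBCF φ).norm_coe_le_norm _) (norm_nonneg _)
    have : Continuous (toBCF ∘ₗ k.convTest) := by
      refine continuous_of_continuousAt_zero _ ?_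
      rw [ContinuousAt, map_zero]
      refine squeeze_zero_norm hb ?_
      have := ((continuous_toBCF.norm).const_mul C).tendsto 0
      simpa using this
    exact this
  refine continuous_test_iff.2 fun n => ?_
  have hn : ∀ φ, (D ^ n) (k.convTest φ) = k.convTest ((D ^ n) φ) := by
    induction n with
    | zero => intro φ; rfl
    | succ n ih => intro φ; rw [pow_succ, Module.End.mul_apply, Module.End.mul_apply, k.D_convTest, ih]
  simp only [hn]
  exact h0.comp (continuous_D_pow n)

/-- Convolution with `k` as a continuous operator on test functions. -/
def Kernel.convTestL (k : Kernel) : Test →L[ℂ] Test := ⟨k.convTest, k.continuous_convTest⟩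

/-! ## The logarithmic kernels -/

/-- `τ ↦ ln (4 sin² (τ / 2))`. -/
def logSin (τ : ℝ) : ℝ := Real.log (4 * Real.sin (τ / 2) ^ 2)

theorem logSin_periodic : Function.Periodic logSin (2 * π) := by
  intro τ
  have : (τ + 2 * π) / 2 = τ / 2 + π := by ring
  simp only [logSin, this, Real.sin_add_pi, neg_sq]

theorem logSin_intervalIntegrable (a b : ℝ) :
    IntervalIntegrable logSin MeasureTheory.volume a b := by
  have h : MeromorphicOn (fun τ : ℝ => 4 * Real.sin (τ / 2) ^ 2) (Set.uIcc a b) := by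
    intro x _
    apply AnalyticAt.meromorphicAt
    fun_prop
  have h2 := h.intervalIntegrable_log_norm
  simp only [Real.norm_eq_abs, Real.log_abs] at h2
  exact h2

theorem intervalIntegrable_ofReal {f : ℝ → ℝ} {a b : ℝ}
    (h : IntervalIntegrable f MeasureTheory.volume a b) :
    IntervalIntegrable (fun t => (f t : ℂ)) MeasureTheory.volume a b :=
  ⟨h.1.ofReal, h.2.ofReal⟩

/-- The kernel `c ln (4 sin² (τ / 2)) w(τ)` with a continuous periodic weight `w`. -/
def logKernel (c : ℂ) (w : ℝ → ℂ) (hw : Continuous w) (hp : Function.Periodic w (2 * π)) :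
    Kernel where
  toFun τ := c * ((logSin τ : ℂ) * w τ)
  periodic τ := by simp only [logSin_periodic τ, hp τ]
  integrable :=
    ((intervalIntegrable_ofReal (logSin_intervalIntegrable _ _)).mul_continuousOn hw.continuousOn).const_mul c

/-- The kernel `-(1 / 2π) ln (4 sin² (τ / 2))`. -/
def kernelS0 : Kernel :=
  logKernel (-(1 / (2 * π))) (fun _ => 1) continuous_const fun _ => rfl

/-- The kernel `(1 / 4π) ln (4 sin² (τ / 2)) sin τ`. -/
def kernelS1 : Kernel :=
  logKernel (1 / (4 * π)) (fun τ => (Real.sin τ : ℂ)) (by fun_prop)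
    fun τ => by simp only [Real.sin_add_two_pi]

/-- The kernel `-(1 / 8π) ln (4 sin² (τ / 2)) sin² τ`. -/
def kernelS2 : Kernel :=
  logKernel (-(1 / (8 * π))) (fun τ => (Real.sin τ : ℂ) ^ 2) (by fun_prop)
    fun τ => by simp only [Real.sin_add_two_pi]

/-- The constant kernel `i / 2π`. -/
def kernelM0 : Kernel where
  toFun _ := Complex.I / (2 * π)
  periodic _ := rfl
  integrable := intervalIntegrable_const

/-! ## The principal value operator -/

/-- The Cauchy principal value `(1 / 2π) p.v. ∫ cot ((ζ - t) / 2) φ(ζ) dζ` over one period: the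
limit, as `ε → 0+`, of the integral over a period with the points of distance less than `ε` from
the singularity removed. -/
def pvCot (φ : ℝ → ℂ) (t : ℝ) : ℂ :=
  1 / (2 * π) * Filter.limUnder (𝓝[>] (0 : ℝ)) fun ε =>
    ∫ ζ in (t + ε)..(t + 2 * π - ε), (Real.cot ((ζ - t) / 2) : ℂ) * φ ζ

theorem hasDerivAt_logSin {τ : ℝ} (h : Real.sin (τ / 2) ≠ 0) :
    HasDerivAt logSin (Real.cot (τ / 2)) τ := by
  have h1 : HasDerivAt (fun τ : ℝ => 4 * Real.sin (τ / 2) ^ 2)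
      (4 * (2 * Real.sin (τ / 2) * (Real.cos (τ / 2) * (1 / 2)))) τ := by
    have := (((Real.hasDerivAt_sin (τ / 2)).comp τ ((hasDerivAt_id τ).div_const 2)).pow 2).const_mul
      (4 : ℝ)
    simpa [Function.comp_def] using this
  have h2 := h1.log (by positivity)
  refine h2.congr_deriv ?_
  rw [Real.cot_eq_cos_div_sin]
  field_simp

/-- The principal value exists for test functions, and integration by parts gives its value. -/
theorem tendsto_pvCot (φ : Test) (t : ℝ) :
    Filter.Tendsto (fun ε => ∫ ζ in (t + ε)..(t + 2 * π - ε), (Real.cot ((ζ - t) / 2) : ℂ) * φ ζ)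
      (𝓝[>] (0 : ℝ)) (𝓝 (-∫ ζ in t..(t + 2 * π), (logSin (ζ - t) : ℂ) * D φ ζ)) := by
  have hint : ∀ a b, IntervalIntegrable (fun ζ => (logSin (ζ - t) : ℂ) * D φ ζ)
      MeasureTheory.volume a b := fun a b => by
    have h := (logSin_intervalIntegrable (a - t) (b - t)).comp_sub_right t
    simp only [sub_add_cancel] at h
    exact (intervalIntegrable_ofReal h).mul_continuousOn (D φ).continuous.continuousOn
  -- the integrated terms
  have hb : Filter.Tendsto (fun ε => (logSin ε : ℂ) * (φ (t - ε) - φ (t + ε)))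
      (𝓝[>] (0 : ℝ)) (𝓝 0) := by
    have hg : HasDerivAt (fun ε => φ (t - ε) - φ (t + ε)) (-(D φ t) - D φ t) 0 := by
      have h1 : HasDerivAt (fun ε => φ (t - ε)) (-(D φ t)) 0 :=
        HasDerivAt.comp_const_sub t 0 (by simpa using φ.hasDerivAt t)
      have h2 : HasDerivAt (fun ε => φ (t + ε)) (D φ t) 0 :=
        HasDerivAt.comp_const_add t 0 (by simpa using φ.hasDerivAt t)
      exact h1.sub h2
    have hO : (fun ε => φ (t - ε) - φ (t + ε)) =O[𝓝 0] fun ε : ℝ => ε := by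
      simpa using hg.isBigO_sub
    have hs : HasDerivAt (fun ε : ℝ => Real.sin (ε / 2)) (1 / 2) 0 := by
      have := (Real.hasDerivAt_sin ((0 : ℝ) / 2)).comp 0 ((hasDerivAt_id (0 : ℝ)).div_const 2)
      simpa [Function.comp_def] using this
    have hO2 : (fun ε : ℝ => ε) =O[𝓝 0] fun ε => Real.sin (ε / 2) := by
      have h := (hs.isTheta_sub (by norm_num)).symm.isBigO
      simpa [Function.comp_def] using h
    have hlim : Filter.Tendsto (fun ε : ℝ => logSin ε * Real.sin (ε / 2)) (𝓝 0) (𝓝 0) := by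
      have hc : Continuous fun x : ℝ => x * Real.log 4 + 2 * (x * Real.log x) := by
        have := Real.continuous_mul_log
        fun_prop
      have he : (fun ε : ℝ => logSin ε * Real.sin (ε / 2)) =
          fun ε => Real.sin (ε / 2) * Real.log 4 +
            2 * (Real.sin (ε / 2) * Real.log (Real.sin (ε / 2))) := by
        funext ε
        by_cases h : Real.sin (ε / 2) = 0
        · simp [h]
        · rw [logSin, Real.log_mul (by norm_num) (by positivity), Real.log_pow]
          push_cast; ring
      rw [he]
      have := (hc.comp (Real.continuous_sin.comp (continuous_id.div_const 2))).tendsto (0 : ℝ)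
      simpa [Function.comp_def] using this
    have hO3 : (fun ε => (logSin ε : ℂ) * (φ (t - ε) - φ (t + ε))) =O[𝓝 0]
        fun ε => logSin ε * Real.sin (ε / 2) := by
      refine Asymptotics.IsBigO.mul ?_ (hO.trans hO2)
      exact Asymptotics.isBigO_of_le _ fun ε => by simp
    exact (hO3.trans_tendsto hlim).mono_left nhdsWithin_le_nhds
  -- the remaining integral
  have hi : Filter.Tendsto
      (fun ε => ∫ ζ in (t + ε)..(t + 2 * π - ε), (logSin (ζ - t) : ℂ) * D φ ζ)
      (𝓝[>] (0 : ℝ)) (𝓝 (∫ ζ in t..(t + 2 * π), (logSin (ζ - t) : ℂ) * D φ ζ)) := by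
    have hP := intervalIntegral.continuous_primitive hint t
    have he : (fun ε => ∫ ζ in (t + ε)..(t + 2 * π - ε), (logSin (ζ - t) : ℂ) * D φ ζ) =
        fun ε => (∫ ζ in t..(t + 2 * π - ε), (logSin (ζ - t) : ℂ) * D φ ζ) -
          ∫ ζ in t..(t + ε), (logSin (ζ - t) : ℂ) * D φ ζ := by
      funext ε
      rw [intervalIntegral.integral_interval_sub_left (hint _ _) (hint _ _)]
    rw [he]
    have h1 := (hP.comp (continuous_const.sub continuous_id :
      Continuous fun ε : ℝ => t + 2 * π - ε)).sub
        (hP.comp (continuous_const.add continuous_id : Continuous fun ε : ℝ => t + ε))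
    have h2 := (h1.tendsto 0).mono_left (nhdsWithin_le_nhds (s := Set.Ioi (0 : ℝ)))
    simpa [Function.comp_def, Pi.sub_def] using h2
  have hmain := hb.sub hi
  rw [zero_sub] at hmain
  refine hmain.congr' ?_
  filter_upwards [Ioo_mem_nhdsGT Real.pi_pos] with ε hε
  have hsin : ∀ ζ ∈ Set.uIcc (t + ε) (t + 2 * π - ε), Real.sin ((ζ - t) / 2) ≠ 0 := by
    intro ζ hζ
    rw [Set.uIcc_of_le (by linarith [hε.2])] at hζ
    exact (Real.sin_pos_of_pos_of_lt_pi (by linarith [hζ.1, hε.1])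
      (by linarith [hζ.2, hε.1])).ne'
  have hparts := intervalIntegral.integral_mul_deriv_eq_deriv_mul
    (a := t + ε) (b := t + 2 * π - ε) (u := φ) (v := fun ζ => (logSin (ζ - t) : ℂ))
    (u' := D φ) (v' := fun ζ => (Real.cot ((ζ - t) / 2) : ℂ))
    (fun ζ _ => φ.hasDerivAt ζ)
    (fun ζ hζ => ((hasDerivAt_logSin (hsin ζ hζ)).comp_sub_const ζ t).ofReal_comp)
    ((D φ).continuous.intervalIntegrable _ _)
    (ContinuousOn.intervalIntegrable (Complex.continuous_ofReal.comp_continuousOn (by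
      simp only [Real.cot_eq_cos_div_sin]
      exact ContinuousOn.div (by fun_prop) (by fun_prop) hsin)))
  have e1 : logSin (t + 2 * π - ε - t) = logSin ε := by
    have : (t + 2 * π - ε - t) / 2 = π - ε / 2 := by ring
    simp only [logSin, this, Real.sin_pi_sub]
  have e2 : φ (t + 2 * π - ε) = φ (t - ε) := by
    rw [← φ.periodic (t - ε)]; congr 1; ring
  have e3 : t + ε - t = ε := by ring
  simp only [e1, e2, e3] at hparts
  simp only [mul_comm (Complex.ofReal (Real.cot _)), hparts, mul_comm (D φ _)]
  ring

/-- The principal value, integrated by parts. -/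
theorem pvCot_eq (φ : Test) : pvCot φ = kernelS0.convTest (D φ) := by
  funext t
  rw [pvCot, (tendsto_pvCot φ t).limUnder_eq, Kernel.convTest_apply]
  have hper : Function.Periodic (fun ζ => (logSin (ζ - t) : ℂ) * D φ ζ) (2 * π) := by
    intro ζ
    have h := logSin_periodic (ζ - t)
    have h2 : ζ + 2 * π - t = ζ - t + 2 * π := by ring
    simp only [h2, h, (D φ).periodic ζ]
  rw [hper.intervalIntegral_add_eq t 0, zero_add, mul_neg, ← neg_mul,
    ← intervalIntegral.integral_const_mul]
  refine intervalIntegral.integral_congr fun ζ _ => ?_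
  have h : logSin (ζ - t) = logSin (t - ζ) := by
    have : (ζ - t) / 2 = -((t - ζ) / 2) := by ring
    simp only [logSin, this, Real.sin_neg, neg_sq]
  simp only [h, kernelS0, logKernel, mul_one, mul_assoc]

/-- The principal value operator on test functions. -/
def pvTestL : Test →L[ℂ] Test where
  toFun φ := Test.mk (pvCot φ)
    (by rw [pvCot_eq]; exact Test.smooth _) (by rw [pvCot_eq]; exact Test.periodic _)
  map_add' φ ψ := by
    ext t
    change pvCot (φ + ψ : Test) t = pvCot φ t + pvCot ψ t
    simp only [pvCot_eq, map_add, Test.add_apply]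
  map_smul' c φ := by
    ext t
    change pvCot (c • φ : Test) t = c * pvCot φ t
    simp only [pvCot_eq, map_smul, Test.smul_apply]
  cont := by
    have h : (fun φ : Test => Test.mk (pvCot φ) (by rw [pvCot_eq]; exact Test.smooth _)
        (by rw [pvCot_eq]; exact Test.periodic _)) = fun φ => kernelS0.convTestL (DL φ) := by
      funext φ
      ext t
      exact congrFun (pvCot_eq φ) t
    exact h ▸ kernelS0.convTestL.continuous.comp DL.continuous

@[simp] theorem pvTestL_apply (φ : Test) (t : ℝ) : pvTestL φ t = pvCot φ t := rfl

/-! ## Fourier series of test functions -/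

/-- The trigonometric monomial `t ↦ e^{imt}`. -/
def expo (m : ℤ) : Test :=
  Test.mk (fun t => Complex.exp (Complex.I * m * t))
    (Complex.contDiff_exp.comp (contDiff_const.mul Complex.ofRealCLM.contDiff)) fun t => by
      simp only
      rw [← Complex.exp_periodic.int_mul m (Complex.I * m * t)]
      congr 1; push_cast; ring

theorem expo_apply (m : ℤ) (t : ℝ) : expo m t = Complex.exp (Complex.I * m * t) := rfl

theorem norm_expo (m : ℤ) (t : ℝ) : ‖expo m t‖ = 1 := by
  rw [expo_apply, Complex.norm_exp]; simp

theorem D_expo (m : ℤ) : D (expo m) = (Complex.I * m) • expo m := by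
  ext t
  have h : HasDerivAt (fun t : ℝ => Complex.exp (Complex.I * m * t))
      (Complex.exp (Complex.I * m * t) * (Complex.I * m * 1)) t :=
    (((hasDerivAt_id t).ofReal_comp).const_mul (Complex.I * m)).cexp
  rw [D_apply, Test.smul_apply, expo_apply]
  refine h.deriv.trans ?_
  ring

/-- The Fourier coefficients of a test function. -/
def coef (φ : Test) (m : ℤ) : ℂ := 1 / (2 * π) * ∫ t in (0 : ℝ)..2 * π, φ t * expo (-m) t

theorem norm_coef_le (φ : Test) (m : ℤ) : ‖coef φ m‖ ≤ ‖toBCF φ‖ := by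
  have h := intervalIntegral.norm_integral_le_of_norm_le_const (a := 0) (b := 2 * π)
    (f := fun t => φ t * expo (-m) t) (C := ‖toBCF φ‖) fun t _ => by
      rw [norm_mul, norm_expo, mul_one]; exact (toBCF φ).norm_coe_le_norm t
  have hp := Real.two_pi_pos
  rw [sub_zero, abs_of_pos hp] at h
  have h2 : ‖(1 / (2 * π) : ℂ)‖ = 1 / (2 * π) := by
    rw [show (1 / (2 * π) : ℂ) = ((1 / (2 * π) : ℝ) : ℂ) by push_cast; rfl, Complex.norm_real,
      Real.norm_of_nonneg (by positivity)]
  rw [coef, norm_mul, h2]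
  calc _ ≤ 1 / (2 * π) * (‖toBCF φ‖ * (2 * π)) := by gcongr
    _ = _ := by field_simp

theorem coef_D (φ : Test) (m : ℤ) : coef (D φ) m = Complex.I * m * coef φ m := by
  have h := intervalIntegral.integral_mul_deriv_eq_deriv_mul
    (a := 0) (b := 2 * π) (u := expo (-m)) (v := φ) (u' := D (expo (-m))) (v' := D φ)
    (fun t _ => Test.hasDerivAt _ t) (fun t _ => φ.hasDerivAt t)
    ((Test.continuous _).intervalIntegrable _ _) ((Test.continuous _).intervalIntegrable _ _)
  have e1 := φ.periodic 0
  have e2 := (expo (-m)).periodic 0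
  rw [zero_add] at e1 e2
  rw [e1, e2, sub_self, zero_sub, D_expo] at h
  simp only [Test.smul_apply, mul_assoc, intervalIntegral.integral_const_mul] at h
  simp only [coef, mul_comm (D φ _), mul_comm (φ _), h]
  push_cast; ring

theorem coef_D_pow (k : ℕ) (φ : Test) (m : ℤ) :
    coef ((D ^ k) φ) m = (Complex.I * m) ^ k * coef φ m := by
  induction k generalizing φ with
  | zero => simp
  | succ k ih => rw [pow_succ, Module.End.mul_apply, ih, coef_D]; ring

theorem D_pow_expo (k : ℕ) (m : ℤ) : (D ^ k) (expo m) = (Complex.I * m) ^ k • expo m := by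
  induction k with
  | zero => simp
  | succ k ih => rw [pow_succ, Module.End.mul_apply, D_expo, map_smul, ih, smul_smul]; ring_nf

theorem summable_coef (φ : Test) : Summable (coef φ) := by
  have hs := (Real.summable_one_div_int_pow (p := 2)).2 (by norm_num)
  refine Summable.of_norm_bounded_eventually (hs.mul_left ‖toBCF ((D ^ 2) φ)‖) ?_
  rw [Filter.eventually_cofinite]
  refine (Set.finite_singleton (0 : ℤ)).subset fun m hm => ?_
  by_contra h0
  refine hm ?_
  have h0 : m ≠ 0 := h0
  have h := norm_coef_le ((D ^ 2) φ) m
  rw [coef_D_pow, norm_mul] at h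
  have e : ‖(Complex.I * m) ^ 2‖ = (m : ℝ) ^ 2 := by simp
  rw [e] at h
  have hm2 : (0 : ℝ) < (m : ℝ) ^ 2 := by positivity
  rw [mul_one_div, le_div_iff₀ hm2]
  linarith

theorem hasSum_coef_apply (φ : Test) (t : ℝ) : HasSum (fun m => coef φ m * expo m t) (φ t) := by
  have : Fact (0 < 2 * π) := ⟨Real.two_pi_pos⟩
  let f : C(AddCircle (2 * π), ℂ) :=
    ⟨φ.periodic.lift, continuous_coinduced_dom.2 φ.continuous⟩
  have hexp : ∀ (m : ℤ) (x : ℝ), (fourier m (x : AddCircle (2 * π)) : ℂ) = expo m x := by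
    intro m x
    rw [fourier_coe_apply, expo_apply]
    congr 1
    have : (π : ℂ) ≠ 0 := by exact_mod_cast Real.pi_ne_zero
    push_cast
    field_simp
  have hcoef : ∀ m, fourierCoeff f m = coef φ m := by
    intro m
    rw [fourierCoeff_eq_intervalIntegral f m 0, zero_add, coef, Complex.real_smul]
    push_cast
    congr 1
    refine intervalIntegral.integral_congr fun x _ => ?_
    change (fourier (-m) (x : AddCircle (2 * π)) : ℂ) • φ x = _
    rw [hexp, smul_eq_mul, mul_comm]
  have hs : Summable (fourierCoeff f) := by
    rw [show fourierCoeff f = coef φ from funext hcoef]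
    exact summable_coef φ
  have h := has_pointwise_sum_fourier_series_of_summable hs (t : AddCircle (2 * π))
  simp only [hcoef, hexp, smul_eq_mul] at h
  exact h

/-- The Fourier series of a test function converges to it with all derivatives. -/
theorem hasSum_coef (φ : Test) : HasSum (fun m => coef φ m • expo m) φ := by
  have hind : Topology.IsInducing jet := ⟨rfl⟩
  rw [← hind.hasSum_iff, Pi.hasSum]
  intro k
  have h0 : ∀ ψ : Test, HasSum (fun m => coef ψ m • toBCF (expo m)) (toBCF ψ) := by
    intro ψ
    have hn : ∀ m, ‖coef ψ m • toBCF (expo m)‖ ≤ ‖coef ψ m‖ := fun m => by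
      rw [norm_smul]
      refine mul_le_of_le_one_right (norm_nonneg _) ?_
      exact (BoundedContinuousFunction.norm_le zero_le_one).2 fun t => (norm_expo m t).le
    have hs : Summable fun m => coef ψ m • toBCF (expo m) :=
      Summable.of_norm_bounded (summable_coef ψ).norm hn
    obtain ⟨S, hS⟩ := hs
    have : S = toBCF ψ := by
      ext t
      have h1 := hS.map (BoundedContinuousFunction.evalCLM ℂ t)
        (BoundedContinuousFunction.evalCLM ℂ t).continuous
      exact h1.unique (hasSum_coef_apply ψ t)
    exact this ▸ hS
  have h1 := h0 ((D ^ k) φ)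
  have e : (fun m => coef ((D ^ k) φ) m • toBCF (expo m)) =
      fun m => (jet (coef φ m • expo m)) k := by
    funext m
    change _ = toBCF ((D ^ k) (coef φ m • expo m))
    rw [map_smul, D_pow_expo, coef_D_pow, smul_smul, map_smul, mul_comm]
  rw [e] at h1
  exact h1

/-! ## Periodic distributions -/

/-- The `2π`-periodic distributions: the continuous linear functionals on the test functions.
A function `u` is identified with `φ ↦ ∫_0^{2π} u(t) φ(t) dt`. -/
abbrev Dist : Type := Test →L[ℂ] ℂ

/-- The Fourier coefficient `û_m = (1 / 2π) ⟨u, e^{-imt}⟩` of a periodic distribution. -/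
def fc (u : Dist) (m : ℤ) : ℂ := 1 / (2 * π) * u (expo (-m))

theorem fc_add (u v : Dist) (m : ℤ) : fc (u + v) m = fc u m + fc v m := by
  simp [fc, mul_add]

theorem fc_smul (c : ℂ) (u : Dist) (m : ℤ) : fc (c • u) m = c * fc u m := by
  simp [fc]; ring

theorem fc_injective : Function.Injective fc := by
  intro u v h
  have hexp : ∀ m, u (expo m) = v (expo m) := by
    intro m
    have := congrFun h (-m)
    simp only [fc, neg_neg] at this
    have hp : (1 / (2 * π) : ℂ) ≠ 0 := by
      have : (π : ℂ) ≠ 0 := by exact_mod_cast Real.pi_ne_zero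
      simp [this]
    exact mul_left_cancel₀ hp this
  ext φ
  have h1 := (hasSum_coef φ).mapL u
  have h2 := (hasSum_coef φ).mapL v
  simp only [map_smul, hexp] at h1 h2
  exact h1.unique h2

/-- The operator on distributions dual to an operator `A` on test functions:
`⟨dual A u, φ⟩ = ⟨u, A φ⟩`. -/
def dual (A : Test →L[ℂ] Test) : Module.End ℂ Dist where
  toFun u := u.comp A
  map_add' _ _ := rfl
  map_smul' _ _ := rfl

/-- The distributional derivative: `⟨derivD u, φ⟩ = -⟨u, φ'⟩`. -/
def derivD : Module.End ℂ Dist := -dual DL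

/-- Multiplication of a distribution by a smooth periodic function, `⟨a u, φ⟩ = ⟨u, a φ⟩`. -/
def mulD (a : Test) : Module.End ℂ Dist := dual (mulTestL a)

/-- The integral operator `u ↦ ∫_0^{2π} k(· - ζ) u(ζ) dζ` on distributions. By Fubini, its
transpose has the kernel `k(ζ - t)`. -/
def convD (k : Kernel) : Module.End ℂ Dist := dual k.reflect.convTestL

/-- The operator `u ↦ (1 / 2π) p.v. ∫ cot ((ζ - ·) / 2) u(ζ) dζ` on distributions. Its kernel is
odd, so its transpose is its negative. -/
def pvD : Module.End ℂ Dist := -dual pvTestL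

/-! ## Consistency with the classical operators -/

/-- The pairing `∫_0^{2π} φ(t) ψ(t) dt` of two test functions. -/
def pair (φ ψ : Test) : ℂ := ∫ t in (0 : ℝ)..2 * π, φ t * ψ t

/-- A smooth function as a distribution. -/
def ofTest (φ : Test) : Dist where
  toFun ψ := pair φ ψ
  map_add' ψ χ := by
    simp only [pair, Test.add_apply, mul_add]
    exact intervalIntegral.integral_add ((φ.continuous.mul ψ.continuous).intervalIntegrable _ _)
      ((φ.continuous.mul χ.continuous).intervalIntegrable _ _)
  map_smul' c ψ := by
    simp only [pair, Test.smul_apply, mul_left_comm _ c, RingHom.id_apply, smul_eq_mul]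
    exact intervalIntegral.integral_const_mul _ _
  cont := by
    refine continuous_of_continuousAt_zero
      (AddMonoidHom.mk' (pair φ) fun ψ χ => by
        simp only [pair, Test.add_apply, mul_add]
        exact intervalIntegral.integral_add
          ((φ.continuous.mul ψ.continuous).intervalIntegrable _ _)
          ((φ.continuous.mul χ.continuous).intervalIntegrable _ _)) ?_
    rw [ContinuousAt, map_zero]
    have hb : ∀ ψ : Test, ‖pair φ ψ‖ ≤ 2 * π * ‖toBCF φ‖ * ‖toBCF ψ‖ := fun ψ => by
      have h := intervalIntegral.norm_integral_le_of_norm_le_const (a := 0) (b := 2 * π)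
        (f := fun t => φ t * ψ t) (C := ‖toBCF φ‖ * ‖toBCF ψ‖) fun t _ => by
          rw [norm_mul]
          exact mul_le_mul ((toBCF φ).norm_coe_le_norm _) ((toBCF ψ).norm_coe_le_norm _)
            (norm_nonneg _) (norm_nonneg _)
      rw [sub_zero, abs_of_pos Real.two_pi_pos] at h
      exact h.trans_eq (by ring)
    refine squeeze_zero_norm hb ?_
    have := ((continuous_toBCF.norm).const_mul (2 * π * ‖toBCF φ‖)).tendsto 0
    simpa using this

/-- The integral operators with kernels `k(t - ζ)` and `k(ζ - t)` are transposes of each other. -/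
theorem Kernel.pair_conv (k : Kernel) (φ ψ : Test) :
    pair φ (k.reflect.convTest ψ) = pair (k.convTest φ) ψ := by
  have hpos := Real.two_pi_pos
  have hk : MeasureTheory.Integrable k.reflect.toFun
      (MeasureTheory.volume.restrict (Set.Ioc 0 (2 * π))) := k.reflect.integrable.1
  have hk2 : MeasureTheory.Integrable k.toFun
      (MeasureTheory.volume.restrict (Set.Ioc 0 (2 * π))) := k.integrable.1
  have e1 : pair φ (k.reflect.convTest ψ) =
      ∫ t in (0 : ℝ)..2 * π, ∫ τ in (0 : ℝ)..2 * π, φ t * ψ (t - τ) * k.reflect.toFun τ := by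
    refine intervalIntegral.integral_congr fun t _ => ?_
    change φ t * k.reflect.conv ψ t = _
    rw [k.reflect.conv_eq, ← intervalIntegral.integral_const_mul]
    exact intervalIntegral.integral_congr fun τ _ => by ring
  have hcont : Continuous fun z : ℝ × ℝ => φ z.1 * ψ (z.1 - z.2) :=
    (φ.continuous.comp continuous_fst).mul
      (ψ.continuous.comp (continuous_fst.sub continuous_snd))
  have e2 : ∫ t in (0 : ℝ)..2 * π, ∫ τ in (0 : ℝ)..2 * π, φ t * ψ (t - τ) * k.reflect.toFun τ =
      ∫ τ in (0 : ℝ)..2 * π, ∫ t in (0 : ℝ)..2 * π, φ t * ψ (t - τ) * k.reflect.toFun τ := by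
    simp only [intervalIntegral.integral_of_le hpos.le]
    refine MeasureTheory.integral_integral_swap ?_
    refine (hk.comp_snd _).bdd_mul (c := ‖toBCF φ‖ * ‖toBCF ψ‖) hcont.aestronglyMeasurable
      (Filter.Eventually.of_forall fun z => ?_)
    rw [norm_mul]
    exact mul_le_mul ((toBCF φ).norm_coe_le_norm _) ((toBCF ψ).norm_coe_le_norm _)
      (norm_nonneg _) (norm_nonneg _)
  have e3 : ∀ τ, ∫ t in (0 : ℝ)..2 * π, φ t * ψ (t - τ) =
      ∫ t in (0 : ℝ)..2 * π, φ (t + τ) * ψ t := by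
    intro τ
    have hper : Function.Periodic (fun t => φ (t + τ) * ψ t) (2 * π) := by
      intro t
      have h1 := φ.periodic (t + τ)
      have h2 : t + 2 * π + τ = t + τ + 2 * π := by ring
      simp only [h2, h1, ψ.periodic t]
    have h := intervalIntegral.integral_comp_sub_right (a := 0) (b := 2 * π)
      (fun t => φ (t + τ) * ψ t) τ
    simp only [sub_add_cancel] at h
    rw [h, show 2 * π - τ = (0 - τ) + 2 * π by ring, hper.intervalIntegral_add_eq (0 - τ) 0,
      zero_add]
  have e4 : pair (k.convTest φ) ψ =
      ∫ t in (0 : ℝ)..2 * π, ∫ τ in (0 : ℝ)..2 * π, φ (t - τ) * ψ t * k.toFun τ := by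
    refine intervalIntegral.integral_congr fun t _ => ?_
    change k.conv φ t * ψ t = _
    rw [k.conv_eq, ← intervalIntegral.integral_mul_const]
    exact intervalIntegral.integral_congr fun τ _ => by ring
  have hcont2 : Continuous fun z : ℝ × ℝ => φ (z.1 - z.2) * ψ z.1 :=
    (φ.continuous.comp (continuous_fst.sub continuous_snd)).mul
      (ψ.continuous.comp continuous_fst)
  have e5 : ∫ t in (0 : ℝ)..2 * π, ∫ τ in (0 : ℝ)..2 * π, φ (t - τ) * ψ t * k.toFun τ =
      ∫ τ in (0 : ℝ)..2 * π, ∫ t in (0 : ℝ)..2 * π, φ (t - τ) * ψ t * k.toFun τ := by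
    simp only [intervalIntegral.integral_of_le hpos.le]
    refine MeasureTheory.integral_integral_swap ?_
    refine (hk2.comp_snd _).bdd_mul (c := ‖toBCF φ‖ * ‖toBCF ψ‖) hcont2.aestronglyMeasurable
      (Filter.Eventually.of_forall fun z => ?_)
    rw [norm_mul]
    exact mul_le_mul ((toBCF φ).norm_coe_le_norm _) ((toBCF ψ).norm_coe_le_norm _)
      (norm_nonneg _) (norm_nonneg _)
  rw [e1, e2, e4, e5]
  simp only [intervalIntegral.integral_mul_const, e3]
  have hper : Function.Periodic
      (fun τ => (∫ t in (0 : ℝ)..2 * π, φ (t - τ) * ψ t) * k.toFun τ) (2 * π) := by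
    intro τ
    have h1 : ∀ t, φ (t - (τ + 2 * π)) = φ (t - τ) := fun t => by
      rw [← φ.periodic (t - (τ + 2 * π))]; congr 1; ring
    simp only [k.periodic τ, h1]
  have h := intervalIntegral.integral_comp_neg (a := 0) (b := 2 * π)
    (fun τ => (∫ t in (0 : ℝ)..2 * π, φ (t - τ) * ψ t) * k.toFun τ)
  have h2 := hper.intervalIntegral_add_eq (-(2 * π)) 0
  simp only [sub_neg_eq_add, neg_add_cancel, zero_add, neg_zero] at h h2
  rw [← h2, ← h]
  rfl

/-- On smooth functions, `convD k` is the integral operator with kernel `k(t - ζ)`. -/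
theorem convD_ofTest (k : Kernel) (φ : Test) : convD k (ofTest φ) = ofTest (k.convTest φ) := by
  ext ψ
  exact k.pair_conv φ ψ

/-- On smooth functions, `mulD a` is pointwise multiplication. -/
theorem mulD_ofTest (a φ : Test) : mulD a (ofTest φ) = ofTest (mulTest a φ) := by
  ext ψ
  refine intervalIntegral.integral_congr fun t _ => ?_
  change φ t * (a t * ψ t) = a t * φ t * ψ t
  ring

theorem pair_D (φ ψ : Test) : pair φ (D ψ) = -pair (D φ) ψ := by
  have h := intervalIntegral.integral_mul_deriv_eq_deriv_mul
    (a := 0) (b := 2 * π) (u := φ) (v := ψ) (u' := D φ) (v' := D ψ)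
    (fun t _ => φ.hasDerivAt t) (fun t _ => ψ.hasDerivAt t)
    ((Test.continuous _).intervalIntegrable _ _) ((Test.continuous _).intervalIntegrable _ _)
  have e1 := φ.periodic 0
  have e2 := ψ.periodic 0
  rw [zero_add] at e1 e2
  rw [e1, e2, sub_self, zero_sub] at h
  exact h

/-- On smooth functions, `derivD` is the derivative. -/
theorem derivD_ofTest (φ : Test) : derivD (ofTest φ) = ofTest (D φ) := by
  ext ψ
  change -pair φ (D ψ) = pair (D φ) ψ
  rw [pair_D, neg_neg]

/-- On smooth functions, `pvD` is the principal value operator. -/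
theorem pvD_ofTest (φ : Test) : pvD (ofTest φ) = ofTest (pvTestL φ) := by
  have hS : kernelS0.reflect.convTest = kernelS0.convTest := by
    have : kernelS0.reflect = kernelS0 := by
      have hl : ∀ τ, logSin (-τ) = logSin τ := fun τ => by
        simp only [logSin, neg_div, Real.sin_neg, neg_sq]
      simp only [Kernel.reflect, kernelS0, logKernel, hl]
    rw [this]
  have hp : ∀ χ : Test, pvTestL χ = kernelS0.convTest (D χ) := fun χ =>
    Test.ext fun t => congrFun (pvCot_eq χ) t
  ext ψ
  change -pair φ (pvTestL ψ) = pair (pvTestL φ) ψ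
  rw [hp, hp, ← hS, Kernel.pair_conv, pair_D, neg_neg, hS, kernelS0.D_convTest]

/-- The Fourier coefficients of a smooth function are those of the distribution it defines. -/
theorem fc_ofTest (φ : Test) : fc (ofTest φ) = coef φ := rfl

/-! ## The operators `S₀`, `S₁`, `S₂`, `T₀` -/

/-- `M₀ φ = (i / 2π) ∫_0^{2π} φ(ζ) dζ`. -/
def M0 : Module.End ℂ Dist := convD kernelM0

/-- `S₀ φ = -(1 / 2π) ∫_0^{2π} ln (4 sin² ((t - ζ) / 2)) φ(ζ) dζ + M₀ φ`. -/
def S0 : Module.End ℂ Dist := convD kernelS0 + M0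

/-- `S₁ φ = (1 / 4π) ∫_0^{2π} ln (4 sin² ((t - ζ) / 2)) sin (t - ζ) φ(ζ) dζ`. -/
def S1 : Module.End ℂ Dist := convD kernelS1

/-- `S₂ φ = -(1 / 8π) ∫_0^{2π} ln (4 sin² ((t - ζ) / 2)) sin² (t - ζ) φ(ζ) dζ`. -/
def S2 : Module.End ℂ Dist := convD kernelS2

/-- `T₀ φ = (1 / 2π) p.v. ∫_0^{2π} cot ((ζ - t) / 2) φ'(ζ) dζ + M₀ φ`. -/
def T0 : Module.End ℂ Dist := pvD * derivD + M0

/-! ## The boundary curve and the multiplication operators -/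

/-- A regular real-analytic `2π`-periodic parametrization of a closed curve in the plane. -/
structure AnalyticCurve where
  /-- the parametrization -/
  toFun : ℝ → EuclideanSpace ℝ (Fin 2)
  analytic : AnalyticOnNhd ℝ toFun Set.univ
  periodic : Function.Periodic toFun (2 * π)
  regular : ∀ t, deriv toFun t ≠ 0

namespace AnalyticCurve

/-- The `k`-th derivative of the parametrization. -/
def d (γ : AnalyticCurve) (k : ℕ) : ℝ → EuclideanSpace ℝ (Fin 2) := iteratedDeriv k γ.toFun

theorem contDiff_d (γ : AnalyticCurve) (k : ℕ) : ContDiff ℝ ∞ (γ.d k) := by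
  induction k with
  | zero =>
    rw [d, iteratedDeriv_zero]
    exact (contDiffOn_univ.1 (γ.analytic.contDiffOn uniqueDiffOn_univ)).of_le le_top
  | succ k ih =>
    rw [d, iteratedDeriv_succ]
    exact contDiff_deriv ih

theorem periodic_d (γ : AnalyticCurve) (k : ℕ) : Function.Periodic (γ.d k) (2 * π) := by
  induction k with
  | zero => rw [d, iteratedDeriv_zero]; exact γ.periodic
  | succ k ih =>
    rw [d, iteratedDeriv_succ]
    exact periodic_deriv ih

/-- The normal vector `n = (γ₂', -γ₁')`. -/
def n (γ : AnalyticCurve) (t : ℝ) : EuclideanSpace ℝ (Fin 2) := !₂[γ.d 1 t 1, -(γ.d 1 t 0)]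

/-- The function `|γ'|²`. -/
def speedSq (γ : AnalyticCurve) : Test :=
  Test.mk (fun t => ((‖γ.d 1 t‖ ^ 2 : ℝ) : ℂ))
    (Complex.ofRealCLM.contDiff.comp ((γ.contDiff_d 1).norm_sq ℝ))
    fun t => by simp only [γ.periodic_d 1 t]

/-- The inner product of the first and the `k`-th derivative of the parametrization. -/
def tangentDot (γ : AnalyticCurve) (k : ℕ) : Test :=
  Test.mk (fun t => ((inner ℝ (γ.d 1 t) (γ.d k t) : ℝ) : ℂ))
    (Complex.ofRealCLM.contDiff.comp ((γ.contDiff_d 1).inner ℝ (γ.contDiff_d k)))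
    fun t => by simp only [γ.periodic_d 1 t, γ.periodic_d k t]

/-- The function `n · γ''`. -/
def normalDot (γ : AnalyticCurve) : Test :=
  Test.mk (fun t => ((inner ℝ (γ.n t) (γ.d 2 t) : ℝ) : ℂ))
    (by
      refine Complex.ofRealCLM.contDiff.comp (ContDiff.inner ℝ ?_ (γ.contDiff_d 2))
      have h := contDiff_euclidean.1 (γ.contDiff_d 1)
      refine contDiff_euclidean.2 fun i => ?_
      fin_cases i
      · simpa [n] using h 1
      · simpa [n] using (h 0).neg)
    fun t => by simp only [n, γ.periodic_d 1 t, γ.periodic_d 2 t]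

/-- `E₁ φ = κ² |γ'|² φ`. -/
def E1 (γ : AnalyticCurve) (κ : ℝ) : Module.End ℂ Dist := (κ ^ 2 : ℂ) • mulD γ.speedSq

/-- `E₂ φ = κ² (n · γ'') φ`. -/
def E2 (γ : AnalyticCurve) (κ : ℝ) : Module.End ℂ Dist := (κ ^ 2 : ℂ) • mulD γ.normalDot

/-- `E₃ φ = κ² (γ' · γ'') φ`. -/
def E3 (γ : AnalyticCurve) (κ : ℝ) : Module.End ℂ Dist := (κ ^ 2 : ℂ) • mulD (γ.tangentDot 2)

/-- `E₄ φ = κ⁴ |γ'|⁴ φ + 2 κ² (γ' · γ^(3)) φ`. -/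
def E4 (γ : AnalyticCurve) (κ : ℝ) : Module.End ℂ Dist :=
  (κ ^ 4 : ℂ) • (mulD γ.speedSq) ^ 2 + (2 * κ ^ 2 : ℂ) • mulD (γ.tangentDot 3)

/-- `E₅ φ = -(3/4) κ⁴ |γ'|⁴ φ + κ² (γ' · γ^(3)) φ`. -/
def E5 (γ : AnalyticCurve) (κ : ℝ) : Module.End ℂ Dist :=
  (-(3 / 4) * κ ^ 4 : ℂ) • (mulD γ.speedSq) ^ 2 + (κ ^ 2 : ℂ) • mulD (γ.tangentDot 3)

/-- `E₆ = E₄ - E₅`. -/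
def E6 (γ : AnalyticCurve) (κ : ℝ) : Module.End ℂ Dist := γ.E4 κ - γ.E5 κ

end AnalyticCurve

/-! ## The operator matrices -/

/-- The operator matrix `[a b; c d]` acting on pairs of distributions. -/
def opMatrix (a b c d : Module.End ℂ Dist) : Module.End ℂ (Dist × Dist) :=
  (a.coprod b).prod (c.coprod d)

theorem opMatrix_apply (a b c d : Module.End ℂ Dist) (ψ : Dist × Dist) :
    opMatrix a b c d ψ = (a ψ.1 + b ψ.2, c ψ.1 + d ψ.2) := rfl

/-- The principal operator `N = N₁ + N₂` of the hypersingular system. -/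
def opN (γ : AnalyticCurve) (κ : ℝ) : Module.End ℂ (Dist × Dist) :=
  opMatrix 1 0 T0 (-1) +
    opMatrix (γ.E2 κ * S2) (S0 + γ.E1 κ * S2)
      ((1 / 2 : ℂ) • (γ.E1 κ * S0) + γ.E3 κ * S1 + γ.E6 κ * S2) (-(γ.E2 κ * S2))

/-- The operator `U = diag (I + S₀ T₀ + E₁ S₀ S₀, I + T₀ S₀ + E₁ S₀ S₀)`. -/
def opU (γ : AnalyticCurve) (κ : ℝ) : Module.End ℂ (Dist × Dist) :=
  opMatrix (1 + S0 * T0 + γ.E1 κ * S0 * S0) 0 0 (1 + T0 * S0 + γ.E1 κ * S0 * S0)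

/-! ## Sobolev spaces -/

/-- The weighted Fourier coefficients `(1 + m²)^{s/2} û_m`. -/
def weighted (s : ℝ) (u : Dist) (m : ℤ) : ℂ :=
  (((1 + (m : ℝ) ^ 2) ^ (s / 2) : ℝ) : ℂ) * fc u m

theorem norm_weighted_sq (s : ℝ) (u : Dist) (m : ℤ) :
    ‖weighted s u m‖ ^ 2 = (1 + (m : ℝ) ^ 2) ^ s * ‖fc u m‖ ^ 2 := by
  have h : (0 : ℝ) ≤ 1 + (m : ℝ) ^ 2 := by positivity
  rw [weighted, norm_mul, Complex.norm_real, Real.norm_of_nonneg (by positivity), mul_pow,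
    ← Real.rpow_natCast, ← Real.rpow_mul h]
  congr 2
  push_cast; ring

theorem memlp_weighted_iff (s : ℝ) (u : Dist) : Memℓp (weighted s u) 2 ↔
    Summable fun m : ℤ => (1 + (m : ℝ) ^ 2) ^ s * ‖fc u m‖ ^ 2 := by
  rw [memℓp_gen_iff (by norm_num)]
  refine summable_congr fun m => ?_
  rw [← norm_weighted_sq]
  norm_num

theorem weighted_add (s : ℝ) (u v : Dist) : weighted s (u + v) = weighted s u + weighted s v := by
  funext m; simp [weighted, fc_add, mul_add]

theorem weighted_smul (s : ℝ) (c : ℂ) (u : Dist) : weighted s (c • u) = c • weighted s u := by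
  funext m; simp [weighted, fc_smul]; ring

/-- The periodic distributions with `Σ (1 + m²)^s |û_m|² < ∞`. -/
def sobolevSubmodule (s : ℝ) : Submodule ℂ Dist where
  carrier := {u | Summable fun m : ℤ => (1 + (m : ℝ) ^ 2) ^ s * ‖fc u m‖ ^ 2}
  add_mem' := fun {u v} hu hv => by
    rw [Set.mem_ofPred_eq, ← memlp_weighted_iff] at *
    rw [weighted_add]
    exact hu.add hv
  zero_mem' := by simp [fc]
  smul_mem' := fun c u hu => by
    rw [Set.mem_ofPred_eq, ← memlp_weighted_iff] at *
    rw [weighted_smul]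
    exact hu.const_smul c

/-- The periodic Sobolev space `H^s[0, 2π]`. -/
def Sobolev (s : ℝ) : Type := sobolevSubmodule s

instance (s : ℝ) : AddCommGroup (Sobolev s) := inferInstanceAs (AddCommGroup (sobolevSubmodule s))
instance (s : ℝ) : Module ℂ (Sobolev s) := inferInstanceAs (Module ℂ (sobolevSubmodule s))

/-- The inclusion of `H^s` in the space of periodic distributions. -/
def toDist (s : ℝ) : Sobolev s →ₗ[ℂ] Dist := (sobolevSubmodule s).subtype

theorem toDist_injective (s : ℝ) : Function.Injective (toDist s) := Subtype.val_injective

theorem mem_range_toDist {s : ℝ} {u : Dist} : u ∈ LinearMap.range (toDist s) ↔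
    Summable fun m : ℤ => (1 + (m : ℝ) ^ 2) ^ s * ‖fc u m‖ ^ 2 :=
  iff_of_eq (congrArg (u ∈ ·) (Submodule.range_subtype (sobolevSubmodule s)))

/-- The map `u ↦ ((1 + m²)^{s/2} û_m)_m` from `H^s` to `ℓ²`. -/
def toL2 (s : ℝ) : Sobolev s →ₗ[ℂ] lp (fun _ : ℤ => ℂ) 2 where
  toFun u := ⟨weighted s (toDist s u), (memlp_weighted_iff s _).2 u.2⟩
  map_add' u v := Subtype.ext (weighted_add s (toDist s u) (toDist s v))
  map_smul' c u := Subtype.ext (weighted_smul s c (toDist s u))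

theorem toL2_injective (s : ℝ) : Function.Injective (toL2 s) := by
  intro u v h
  refine toDist_injective s (fc_injective (funext fun m => ?_))
  have hm : weighted s (toDist s u) m = weighted s (toDist s v) m :=
    congrFun (congrArg Subtype.val h) m
  have hp : (0 : ℝ) < (1 + (m : ℝ) ^ 2) ^ (s / 2) := by positivity
  exact mul_left_cancel₀ (Complex.ofReal_ne_zero.2 hp.ne') hm

/-- The norm of `H^s`, see `Sobolev.norm_sq`. -/
instance (s : ℝ) : NormedAddCommGroup (Sobolev s) :=
  NormedAddCommGroup.induced (Sobolev s) (lp (fun _ : ℤ => ℂ) 2) (toL2 s) (toL2_injective s)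

instance (s : ℝ) : NormedSpace ℂ (Sobolev s) :=
  NormedSpace.induced ℂ (Sobolev s) (lp (fun _ : ℤ => ℂ) 2) (toL2 s)

/-- `‖u‖_s² = Σ (1 + m²)^s |û_m|²`. -/
theorem Sobolev.norm_sq (s : ℝ) (u : Sobolev s) :
    ‖u‖ ^ 2 = ∑' m : ℤ, (1 + (m : ℝ) ^ 2) ^ s * ‖fc (toDist s u) m‖ ^ 2 := by
  have h := lp.norm_rpow_eq_tsum (p := 2) (by norm_num) (toL2 s u)
  simp only [ENNReal.toReal_ofNat, Real.rpow_ofNat] at h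
  refine h.trans (tsum_congr fun m => ?_)
  exact norm_weighted_sq s (toDist s u) m

/-- The inclusion of `H^s[0, 2π]²` in the space of pairs of periodic distributions. -/
def toDist2 (s : ℝ) : Sobolev s × Sobolev s →ₗ[ℂ] Dist × Dist := (toDist s).prodMap (toDist s)

end Biharmonic

namespace Biharmonic

/-! ## Fourier symbols of the convolution operators -/

/-! The operators S₀, S₁, S₂, T₀ are Fourier multipliers. Their symbols follow from the coefficients
of ln(4 sin²(τ/2)), which are -2π/|m| for m ≠ 0 and 0 for m = 0 (`logSym_eq`). Away from finitely
many m, S₀ has symbol 1/|m|, T₀ has -|m|, S₁ is O(|m|⁻²), and S₂ has -1/(2|m|(m²-4)). The rank-one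
term makes both S₀ and T₀ equal to i at m = 0, so S₀T₀ = T₀S₀ = -I exactly (`symS0_mul_symT0`).
Hence 𝒰 is diagonal with both entries E₁S₀², and T₀²E₁⁻¹ inverts that entry. This is where κ ≠ 0 and
γ' ≠ 0 enter (`exists_equiv`).

The remaining task is to expand 𝒩² modulo operators of order -3. In a diagonal entry I cancels
against S₀T₀ or T₀S₀, and E₁S₀² appears in two halves. One half is E₁S₂T₀, because S₂T₀ and S₀²/2
have the same leading symbol 1/(2m²) (`hasOrder_S2_mul_T0_sub`). The other is the product of S₀ with
E₁S₀/2. The diagonal entries of 𝒩 are negatives of each other, so the off-diagonal entries of 𝒩² are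
commutators.

Everything thus rests on commutators with a multiplication operator being one order better than the
product. For T₀ this holds because ||m| - |m-k|| ≤ |k| while the Fourier coefficients of a smooth
function decay rapidly (`hasOrder_commutator`). For S₀ it follows by conjugation with S₀
(`hasOrder_S0_commutator`). `exists_opN_sq_eq` collects the remainders, all of order -3. Such an
operator maps H^p to H^{p+3}, which embeds compactly in H^{p+2} (`exists_compact_inclusion`). -/

/-- The Fourier symbol of the convolution with `k`. -/
def Kernel.symbol (k : Kernel) (m : ℤ) : ℂ := ∫ τ in (0 : ℝ)..2 * π, k.toFun τ * expo (-m) τ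

theorem expo_mul_expo (m n : ℤ) (t : ℝ) : expo m t * expo n t = expo (m + n) t := by
  simp only [expo_apply, ← Complex.exp_add]
  congr 1; push_cast; ring

theorem expo_zero (t : ℝ) : expo 0 t = 1 := by simp [expo_apply]

theorem expo_sub (m : ℤ) (s t : ℝ) : expo m (s - t) = expo m s * expo (-m) t := by
  simp only [expo_apply, ← Complex.exp_add]
  congr 1; push_cast; ring

theorem expo_neg_arg (m : ℤ) (t : ℝ) : expo m (-t) = expo (-m) t := by
  simp only [expo_apply]
  congr 1; push_cast; ring

theorem integral_expo (m : ℤ) :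
    ∫ t in (0 : ℝ)..2 * π, expo m t = if m = 0 then (2 * π : ℂ) else 0 := by
  split_ifs with h
  · subst h
    simp [expo_zero]
  · have hd : ∀ t ∈ Set.uIcc 0 (2 * π), HasDerivAt (expo m) (D (expo m) t) t :=
      fun t _ => (expo m).hasDerivAt t
    have := intervalIntegral.integral_eq_sub_of_hasDerivAt hd
      ((Test.continuous _).intervalIntegrable _ _)
    have e := (expo m).periodic 0
    rw [zero_add] at e
    rw [e, sub_self, D_expo] at this
    simp only [Test.smul_apply, intervalIntegral.integral_const_mul] at this
    have hm : (Complex.I * m : ℂ) ≠ 0 := by simp [h]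
    exact (mul_eq_zero.1 this).resolve_left hm

/-- Exponentials turn translations into scalars, so they are eigenfunctions of every convolution.
The substitution τ ↦ -τ undoes the reflection of the transposed kernel, so the eigenvalue is the
symbol at m and not at -m. -/
theorem Kernel.reflect_convTest_expo (k : Kernel) (m : ℤ) :
    k.reflect.convTest (expo (-m)) = k.symbol m • expo (-m) := by
  ext t
  change k.reflect.conv (expo (-m)) t = _
  rw [k.reflect.conv_eq, Test.smul_apply, Kernel.symbol]
  have hper : Function.Periodic (fun τ => k.toFun τ * expo (-m) τ) (2 * π) :=
    k.periodic.mul (expo (-m)).periodic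
  have h := intervalIntegral.integral_comp_neg (a := 0) (b := 2 * π)
    (fun τ => k.toFun τ * expo (-m) τ)
  have h2 := hper.intervalIntegral_add_eq (-(2 * π)) 0
  simp only [neg_add_cancel, zero_add, neg_zero] at h h2
  rw [← h2, ← h, ← intervalIntegral.integral_mul_const]
  refine intervalIntegral.integral_congr fun τ _ => ?_
  simp only [expo_sub, expo_neg_arg, Kernel.reflect]
  ring

theorem fc_convD (k : Kernel) (u : Dist) (m : ℤ) : fc (convD k u) m = k.symbol m * fc u m := by
  change 1 / (2 * π) * u (k.reflect.convTest (expo (-m))) = _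
  rw [k.reflect_convTest_expo, map_smul, fc, smul_eq_mul]
  ring

theorem fc_derivD (u : Dist) (m : ℤ) : fc (derivD u) m = Complex.I * m * fc u m := by
  change 1 / (2 * π) * -(u (D (expo (-m)))) = _
  rw [D_expo, map_smul, fc, smul_eq_mul]
  push_cast; ring

/-! ## Fourier coefficients of the logarithmic kernel -/

/-- The integrals `∫ ln (4 sin² (τ / 2)) e^{-imτ} dτ`. -/
def logSym (m : ℤ) : ℂ := ∫ τ in (0 : ℝ)..2 * π, (logSin τ : ℂ) * expo (-m) τ

theorem intervalIntegrable_logSin_mul (φ : Test) :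
    IntervalIntegrable (fun τ => (logSin τ : ℂ) * φ τ) MeasureTheory.volume 0 (2 * π) :=
  (intervalIntegrable_ofReal (logSin_intervalIntegrable _ _)).mul_continuousOn
    φ.continuous.continuousOn

/-- The recursion below multiplies this coefficient by 0, so it needs its own computation: with τ =
2x, the integral of ln sin over (0, π), which is -π ln 2, cancels the contribution of ln 4. -/
theorem logSym_zero : logSym 0 = 0 := by
  have h1 : ∫ τ in (0 : ℝ)..2 * π, logSin τ = 0 := by
    have hs : ∫ τ in (0 : ℝ)..2 * π, logSin τ = 2 * ∫ x in (0 : ℝ)..π,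
        Real.log (4 * Real.sin x ^ 2) := by
      have := intervalIntegral.integral_comp_div (a := 0) (b := 2 * π)
        (fun x => Real.log (4 * Real.sin x ^ 2)) (c := 2) (by norm_num)
      simp only [zero_div, smul_eq_mul] at this
      rw [show 2 * π / 2 = π by ring] at this
      exact this
    have he : ∫ x in (0 : ℝ)..π, Real.log (4 * Real.sin x ^ 2) =
        ∫ x in (0 : ℝ)..π, (2 * Real.log 2 + 2 * Real.log (Real.sin x)) := by
      refine intervalIntegral.integral_congr_ae ?_
      -- At x = π the sine vanishes and the logarithm of the product does not split.
      have : ∀ᵐ x : ℝ, x ≠ π := by simp [MeasureTheory.ae_iff]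
      filter_upwards [this] with x hx hx2
      rw [Set.uIoc_of_le Real.pi_pos.le] at hx2
      have hp := Real.sin_pos_of_pos_of_lt_pi hx2.1 (lt_of_le_of_ne hx2.2 hx)
      rw [Real.log_mul (by norm_num) (by positivity), Real.log_pow,
        show (4 : ℝ) = 2 ^ 2 by norm_num, Real.log_pow]
      push_cast; ring
    have hi : IntervalIntegrable (fun x => Real.log (Real.sin x)) MeasureTheory.volume 0 π :=
      intervalIntegrable_log_sin
    rw [hs, he, intervalIntegral.integral_add intervalIntegrable_const (hi.const_mul 2),
      intervalIntegral.integral_const, intervalIntegral.integral_const_mul,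
      integral_log_sin_zero_pi]
    simp only [smul_eq_mul]; ring
  simp only [logSym, neg_zero, expo_zero, mul_one, intervalIntegral.integral_ofReal, h1,
    Complex.ofReal_zero]

/-- Both e^{iτ} - 1 = 2i sin(τ/2) e^{iτ/2} and e^{iτ} + 1 = 2 cos(τ/2) e^{iτ/2} come from Euler's
formula. The factor e^{iτ} - 1 thus removes the singularity of the cotangent and leaves a
trigonometric polynomial. -/
theorem cot_mul_expo_sub_one {τ : ℝ} (h : Real.sin (τ / 2) ≠ 0) :
    (Real.cot (τ / 2) : ℂ) * (expo 1 τ - 1) = Complex.I * (expo 1 τ + 1) := by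
  have h' : Complex.sin (τ / 2) ≠ 0 := by
    have : ((Real.sin (τ / 2) : ℝ) : ℂ) ≠ 0 := by exact_mod_cast h
    simpa using this
  have e : expo 1 τ = (Complex.cos (τ / 2) + Complex.sin (τ / 2) * Complex.I) ^ 2 := by
    rw [← Complex.exp_mul_I, ← Complex.exp_nat_mul, expo_apply]
    congr 1; push_cast; ring
  have hI := Complex.I_sq
  have hcs := Complex.sin_sq_add_cos_sq (τ / 2 : ℂ)
  rw [e, Real.cot_eq_cos_div_sin]
  push_cast
  field_simp
  generalize Complex.cos (τ / 2) = c at *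
  generalize Complex.sin (τ / 2) = s at *
  linear_combination (-c * s ^ 2 - s ^ 3 * Complex.I) * hI + (c + s * Complex.I) * hcs

/-- Integration by parts against `e^{-imτ} (e^{iτ} - 1)`, which vanishes at the singularity. -/
theorem logSym_rec (m : ℤ) : (m : ℂ) * logSym m - (m - 1) * logSym (m - 1) =
    -((if m = 1 then (2 * π : ℂ) else 0) + if m = 0 then (2 * π : ℂ) else 0) := by
  set φ : Test := expo (1 - m) - expo (-m) with hφ
  have hφa : ∀ t, φ t = expo (-m) t * (expo 1 t - 1) := fun t => by
    have : φ t = expo (1 - m) t - expo (-m) t := rfl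
    rw [this, mul_sub, expo_mul_expo, mul_one, neg_add_eq_sub]
  -- The limit of the truncated cotangent integrals is computed twice: by parts here, giving
  -- logarithmic integrals, and as the integral of the trigonometric polynomial `g` in `h2`.
  have h := tendsto_pvCot φ 0
  simp only [zero_add, sub_zero] at h
  set g : Test := Complex.I • (expo (1 - m) + expo (-m)) with hg
  have h2 : Filter.Tendsto (fun ε => ∫ ζ in ε..(2 * π - ε), (Real.cot (ζ / 2) : ℂ) * φ ζ)
      (𝓝[>] (0 : ℝ)) (𝓝 (∫ ζ in (0 : ℝ)..2 * π, g ζ)) := by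
    have hi : ∀ a b, IntervalIntegrable g MeasureTheory.volume a b :=
      fun a b => g.continuous.intervalIntegrable a b
    have hP := intervalIntegral.continuous_primitive hi 0
    have hc : Continuous fun ε : ℝ => (∫ ζ in (0 : ℝ)..(2 * π - ε), g ζ) - ∫ ζ in (0 : ℝ)..ε, g ζ :=
      (hP.comp (continuous_const.sub continuous_id)).sub hP
    have ht := (hc.tendsto 0).mono_left (nhdsWithin_le_nhds (s := Set.Ioi (0 : ℝ)))
    simp only [sub_zero, intervalIntegral.integral_same] at ht
    refine ht.congr' ?_
    filter_upwards [Ioo_mem_nhdsGT Real.pi_pos] with ε hε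
    rw [intervalIntegral.integral_interval_sub_left (hi _ _) (hi _ _)]
    refine intervalIntegral.integral_congr fun ζ hζ => ?_
    rw [Set.uIcc_of_le (by linarith [hε.2])] at hζ
    have hsin := (Real.sin_pos_of_pos_of_lt_pi (x := ζ / 2) (by linarith [hζ.1, hε.1])
      (by linarith [hζ.2, hε.1])).ne'
    change Complex.I * (expo (1 - m) ζ + expo (-m) ζ) = _
    simp only [hφa]
    rw [mul_left_comm, cot_mul_expo_sub_one hsin, show 1 - m = -m + 1 by ring, ← expo_mul_expo]
    ring
  have h3 := tendsto_nhds_unique h h2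
  have hgi : ∫ ζ in (0 : ℝ)..2 * π, g ζ =
      Complex.I * ((if m = 1 then (2 * π : ℂ) else 0) + if m = 0 then (2 * π : ℂ) else 0) := by
    have : ∀ ζ, g ζ = Complex.I * (expo (1 - m) ζ + expo (-m) ζ) := fun ζ => rfl
    simp only [this, intervalIntegral.integral_const_mul]
    rw [intervalIntegral.integral_add ((Test.continuous _).intervalIntegrable _ _)
      ((Test.continuous _).intervalIntegrable _ _), integral_expo, integral_expo]
    simp only [sub_eq_zero, eq_comm (a := (1 : ℤ)), neg_eq_zero]
  have hD : ∀ ζ, (logSin ζ : ℂ) * D φ ζ = -(Complex.I * (m - 1)) * ((logSin ζ : ℂ) *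
      expo (-(m - 1)) ζ) + Complex.I * m * ((logSin ζ : ℂ) * expo (-m) ζ) := fun ζ => by
    rw [hφ, map_sub, D_expo, D_expo]
    change (logSin ζ : ℂ) * ((Complex.I * ((1 - m : ℤ) : ℂ)) * expo (1 - m) ζ -
      (Complex.I * ((-m : ℤ) : ℂ)) * expo (-m) ζ) = _
    rw [show -(m - 1) = 1 - m by ring]
    push_cast; ring
  simp only [hD] at h3
  rw [intervalIntegral.integral_add ((intervalIntegrable_logSin_mul _).const_mul _)
    ((intervalIntegrable_logSin_mul _).const_mul _), intervalIntegral.integral_const_mul,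
    intervalIntegral.integral_const_mul, hgi] at h3
  change -(-(Complex.I * (m - 1)) * logSym (m - 1) + Complex.I * m * logSym m) = _ at h3
  refine mul_left_cancel₀ Complex.I_ne_zero ?_
  linear_combination -h3

/-- By `logSym_rec`, the product of m and the coefficient is constant on m ≥ 1 and on m ≤ -1. The
steps at m = 1 and m = 0, where the unknown at 0 has factor 0, fix the two constants. At m = 0 the
convention 0⁻¹ = 0 agrees with `logSym_zero`. -/
theorem logSym_eq (m : ℤ) : logSym m = -(2 * π) * ((|m| : ℤ) : ℂ)⁻¹ := by
  have hpos : ∀ n : ℕ, ((n : ℂ) + 1) * logSym (n + 1) = -(2 * π) := by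
    intro n
    induction n with
    | zero =>
      have := logSym_rec 1
      simpa using this
    | succ n ih =>
      have := logSym_rec (n + 2)
      rw [show (n : ℤ) + 2 - 1 = n + 1 by ring, if_neg (by omega), if_neg (by omega)] at this
      push_cast at this ⊢
      rw [show (n : ℤ) + 1 + 1 = n + 2 by ring]
      linear_combination this + ih
  have hneg : ∀ n : ℕ, ((n : ℂ) + 1) * logSym (-(n + 1)) = -(2 * π) := by
    intro n
    induction n with
    | zero =>
      have := logSym_rec 0
      simp at this
      simpa using this
    | succ n ih =>
      have := logSym_rec (-(n + 1))
      rw [show -((n : ℤ) + 1) - 1 = -(n + 2) by ring, if_neg (by omega), if_neg (by omega)] at this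
      push_cast at this ⊢
      rw [show (n : ℤ) + 1 + 1 = n + 2 by ring]
      linear_combination this + ih
  rcases lt_trichotomy m 0 with h | h | h
  · obtain ⟨n, rfl⟩ : ∃ n : ℕ, m = -(n + 1) := ⟨(-m - 1).toNat, by omega⟩
    have hn : ((n : ℂ) + 1) ≠ 0 := by exact_mod_cast n.succ_ne_zero
    rw [abs_of_neg h, eq_mul_inv_iff_mul_eq₀ (by push_cast; simpa using hn), ← hneg n]
    push_cast; ring
  · simp [h, logSym_zero]
  · obtain ⟨n, rfl⟩ : ∃ n : ℕ, m = n + 1 := ⟨(m - 1).toNat, by omega⟩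
    have hn : ((n : ℂ) + 1) ≠ 0 := by exact_mod_cast n.succ_ne_zero
    rw [abs_of_pos h, eq_mul_inv_iff_mul_eq₀ (by push_cast; simpa using hn), ← hpos n]
    push_cast; ring

/-! ## Symbols of `S₀`, `S₁`, `S₂`, `T₀` -/

/-- The symbol of `S₀`. -/
def symS0 (m : ℤ) : ℂ := ((|m| : ℤ) : ℂ)⁻¹ + if m = 0 then Complex.I else 0

/-- The symbol of `T₀`. -/
def symT0 (m : ℤ) : ℂ := -((|m| : ℤ) : ℂ) + if m = 0 then Complex.I else 0

/-- The symbol of `S₁`. -/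
def symS1 (m : ℤ) : ℂ :=
  Complex.I / 4 * (((|m - 1| : ℤ) : ℂ)⁻¹ - ((|m + 1| : ℤ) : ℂ)⁻¹)

/-- The symbol of `S₂`. -/
def symS2 (m : ℤ) : ℂ :=
  1 / 16 * (2 * ((|m| : ℤ) : ℂ)⁻¹ - ((|m - 2| : ℤ) : ℂ)⁻¹ - ((|m + 2| : ℤ) : ℂ)⁻¹)

theorem pi_ne_zero_complex : (π : ℂ) ≠ 0 := Complex.ofReal_ne_zero.2 Real.pi_ne_zero

theorem symbol_kernelS0 (m : ℤ) : kernelS0.symbol m = ((|m| : ℤ) : ℂ)⁻¹ := by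
  have h : kernelS0.symbol m = -(1 / (2 * π)) * logSym m := by
    rw [logSym, ← intervalIntegral.integral_const_mul]
    refine intervalIntegral.integral_congr fun τ _ => ?_
    simp only [kernelS0, logKernel]; ring
  have := pi_ne_zero_complex
  rw [h, logSym_eq]
  field_simp

theorem symbol_kernelM0 (m : ℤ) : kernelM0.symbol m = if m = 0 then Complex.I else 0 := by
  have h : kernelM0.symbol m = Complex.I / (2 * π) * ∫ t in (0 : ℝ)..2 * π, expo (-m) t :=
    intervalIntegral.integral_const_mul _ _
  have := pi_ne_zero_complex
  rw [h, integral_expo]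
  simp only [neg_eq_zero]
  split_ifs
  · field_simp
  · simp

/-- A factor sin τ in the kernel becomes a central difference with step 1 of the symbol. S₁ uses
this once and S₂ twice. -/
theorem sin_mul_expo (m : ℤ) (τ : ℝ) : (Real.sin τ : ℂ) * expo (-m) τ =
    -(Complex.I / 2) * expo (-(m - 1)) τ + Complex.I / 2 * expo (-(m + 1)) τ := by
  rw [show -(m - 1) = 1 + -m by ring, show -(m + 1) = -1 + -m by ring, ← expo_mul_expo,
    ← expo_mul_expo, Complex.ofReal_sin, Complex.sin, expo_apply 1, expo_apply (-1)]
  rw [show (-τ * Complex.I : ℂ) = Complex.I * ((-1 : ℤ) : ℂ) * τ by push_cast; ring,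
    show (τ * Complex.I : ℂ) = Complex.I * ((1 : ℤ) : ℂ) * τ by push_cast; ring]
  ring

theorem symbol_kernelS1 (m : ℤ) : kernelS1.symbol m = symS1 m := by
  have h : kernelS1.symbol m = 1 / (4 * π) *
      (-(Complex.I / 2) * logSym (m - 1) + Complex.I / 2 * logSym (m + 1)) := by
    simp only [logSym, ← intervalIntegral.integral_const_mul]
    rw [← intervalIntegral.integral_add ((intervalIntegrable_logSin_mul _).const_mul _)
      ((intervalIntegrable_logSin_mul _).const_mul _), ← intervalIntegral.integral_const_mul]
    refine intervalIntegral.integral_congr fun τ _ => ?_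
    simp only [kernelS1, logKernel]
    rw [mul_assoc, mul_assoc, sin_mul_expo]; ring
  have := pi_ne_zero_complex
  rw [h, logSym_eq, logSym_eq, symS1]
  field_simp
  ring

theorem symbol_kernelS2 (m : ℤ) : kernelS2.symbol m = symS2 m := by
  have h : kernelS2.symbol m = -(1 / (8 * π)) *
      (1 / 2 * logSym m + (-(1 / 4) * logSym (m - 2) + -(1 / 4) * logSym (m + 2))) := by
    simp only [logSym, ← intervalIntegral.integral_const_mul]
    rw [← intervalIntegral.integral_add ((intervalIntegrable_logSin_mul _).const_mul _)
      ((intervalIntegrable_logSin_mul _).const_mul _),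
      ← intervalIntegral.integral_add ((intervalIntegrable_logSin_mul _).const_mul _)
        (((intervalIntegrable_logSin_mul _).const_mul _).add
          ((intervalIntegrable_logSin_mul _).const_mul _)), ← intervalIntegral.integral_const_mul]
    refine intervalIntegral.integral_congr fun τ _ => ?_
    simp only [kernelS2, logKernel]
    rw [mul_assoc, mul_assoc, sq, mul_assoc, sin_mul_expo, mul_add, mul_left_comm _ (-_),
      mul_left_comm _ (Complex.I / 2), sin_mul_expo, sin_mul_expo]
    rw [show m - 1 - 1 = m - 2 by ring, show m - 1 + 1 = m by ring, show m + 1 - 1 = m by ring,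
      show m + 1 + 1 = m + 2 by ring]
    linear_combination (-(1 / (8 * π)) * (logSin τ : ℂ) *
      (1 / 4 * expo (-(m - 2)) τ + 1 / 4 * expo (-(m + 2)) τ - 1 / 2 * expo (-m) τ)) *
        Complex.I_sq
  have := pi_ne_zero_complex
  rw [h, logSym_eq, logSym_eq, logSym_eq, symS2]
  field_simp
  ring

theorem fc_S0 (u : Dist) (m : ℤ) : fc (S0 u) m = symS0 m * fc u m := by
  change fc (convD kernelS0 u + convD kernelM0 u) m = _
  rw [fc_add, fc_convD, fc_convD, symbol_kernelS0, symbol_kernelM0, symS0, add_mul]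

theorem fc_S1 (u : Dist) (m : ℤ) : fc (S1 u) m = symS1 m * fc u m := by
  rw [S1, fc_convD, symbol_kernelS1]

theorem fc_S2 (u : Dist) (m : ℤ) : fc (S2 u) m = symS2 m * fc u m := by
  rw [S2, fc_convD, symbol_kernelS2]

/-- By `pvCot_eq` the principal value is the logarithmic operator applied to the derivative. The
minus sign in the dual operator cancels the one from testing with e^{-imt}. -/
theorem fc_pvD (u : Dist) (m : ℤ) :
    fc (pvD u) m = Complex.I * m * ((|m| : ℤ) : ℂ)⁻¹ * fc u m := by
  have hS : kernelS0.reflect = kernelS0 := by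
    have hl : ∀ τ, logSin (-τ) = logSin τ := fun τ => by
      simp only [logSin, neg_div, Real.sin_neg, neg_sq]
    simp only [Kernel.reflect, kernelS0, logKernel, hl]
  have hp : pvTestL (expo (-m)) =
      (Complex.I * ((-m : ℤ) : ℂ) * ((|m| : ℤ) : ℂ)⁻¹) • expo (-m) := by
    have : pvTestL (expo (-m)) = kernelS0.reflect.convTest (D (expo (-m))) := by
      rw [hS]
      exact Test.ext fun t => congrFun (pvCot_eq (expo (-m))) t
    rw [this, D_expo, map_smul, Kernel.reflect_convTest_expo, symbol_kernelS0, smul_smul]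
  change 1 / (2 * π) * -(u (pvTestL (expo (-m)))) = _
  rw [hp, map_smul, fc, smul_eq_mul]
  push_cast; ring

/-- For m ≠ 0 the two derivatives and the logarithmic kernel give (im)²/|m| = -|m|. -/
theorem fc_T0 (u : Dist) (m : ℤ) : fc (T0 u) m = symT0 m * fc u m := by
  change fc (pvD (derivD u) + convD kernelM0 u) m = _
  rw [fc_add, fc_convD, fc_pvD, fc_derivD, symbol_kernelM0, symT0]
  rcases eq_or_ne m 0 with h | h
  · simp [h]
  · have h1 : ((|m| : ℤ) : ℂ) ≠ 0 := by exact_mod_cast abs_ne_zero.2 h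
    have h2 : (m : ℂ) * m = ((|m| : ℤ) : ℂ) * ((|m| : ℤ) : ℂ) := by
      exact_mod_cast (abs_mul_abs_self m).symm
    field_simp
    linear_combination -fc u m * h2 + ((m : ℂ) * m * fc u m) * Complex.I_sq

/-- At m = 0 both moduli contribute 0, since 0⁻¹ = 0, and the rank-one terms give i · i = -1.
Without them neither operator would be invertible. -/
theorem symS0_mul_symT0 (m : ℤ) : symS0 m * symT0 m = -1 := by
  rcases eq_or_ne m 0 with h | h
  · simp [h, symS0, symT0]
  · have h1 : ((|m| : ℤ) : ℂ) ≠ 0 := by exact_mod_cast abs_ne_zero.2 h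
    simp [h, symS0, symT0]

/-- Operators with the same action on Fourier coefficients coincide. -/
theorem end_ext {A B : Module.End ℂ Dist} (h : ∀ u m, fc (A u) m = fc (B u) m) : A = B :=
  LinearMap.ext fun u => fc_injective (funext (h u))

theorem fc_neg (u : Dist) (m : ℤ) : fc (-u) m = -fc u m := by simp [fc]

theorem S0_mul_T0 : S0 * T0 = -1 := end_ext fun u m => by
  change fc (S0 (T0 u)) m = fc (-u) m
  rw [fc_S0, fc_T0, ← mul_assoc, symS0_mul_symT0, fc_neg, neg_one_mul]

theorem T0_mul_S0 : T0 * S0 = -1 := end_ext fun u m => by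
  change fc (T0 (S0 u)) m = fc (-u) m
  rw [fc_T0, fc_S0, ← mul_assoc, mul_comm (symT0 m), symS0_mul_symT0, fc_neg, neg_one_mul]

theorem T0_mul_S2 : T0 * S2 = S2 * T0 := end_ext fun u m => by
  change fc (T0 (S2 u)) m = fc (S2 (T0 u)) m
  rw [fc_T0, fc_S2, fc_S2, fc_T0]; ring

/-! ## Operators of finite order on the Sobolev scale -/

/-- `A` maps `H^s` boundedly to `H^t` whenever `t ≤ s - r`. -/
def HasOrder (r : ℝ) (A : Module.End ℂ Dist) : Prop :=
  ∀ s t : ℝ, t + r ≤ s → ∃ L : Sobolev s →L[ℂ] Sobolev t, ∀ u, toDist t (L u) = A (toDist s u)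

namespace HasOrder

variable {r r' : ℝ} {A B : Module.End ℂ Dist}

theorem mono (h : HasOrder r A) (hr : r ≤ r') : HasOrder r' A :=
  fun s t hst => h s t (by linarith)

theorem mul (hA : HasOrder r A) (hB : HasOrder r' B) : HasOrder (r + r') (A * B) := by
  intro s t hst
  obtain ⟨K, hK⟩ := hB s (s - r') (by linarith)
  obtain ⟨L, hL⟩ := hA (s - r') t (by linarith)
  exact ⟨L.comp K, fun u => (hL _).trans (congrArg A (hK u))⟩

theorem add (hA : HasOrder r A) (hB : HasOrder r B) : HasOrder r (A + B) := by
  intro s t hst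
  obtain ⟨K, hK⟩ := hA s t hst
  obtain ⟨L, hL⟩ := hB s t hst
  refine ⟨K + L, fun u => ?_⟩
  rw [add_apply, map_add, hK, hL]
  rfl

theorem smul (hA : HasOrder r A) (c : ℂ) : HasOrder r (c • A) := by
  intro s t hst
  obtain ⟨K, hK⟩ := hA s t hst
  refine ⟨c • K, fun u => ?_⟩
  rw [smul_apply, map_smul, hK]
  rfl

theorem neg (hA : HasOrder r A) : HasOrder r (-A) :=
  neg_one_smul ℂ A ▸ hA.smul (-1)

theorem sub (hA : HasOrder r A) (hB : HasOrder r B) : HasOrder r (A - B) :=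
  sub_eq_add_neg A B ▸ hA.add hB.neg

end HasOrder

theorem norm_eq_norm_toL2 {s : ℝ} (u : Sobolev s) : ‖u‖ = ‖toL2 s u‖ := rfl

theorem toL2_apply {s : ℝ} (u : Sobolev s) (m : ℤ) : toL2 s u m = weighted s (toDist s u) m := rfl

/-- An estimate in the weighted `ℓ²` norms lifts an operator to the Sobolev spaces. -/
theorem exists_lift {s t : ℝ} (A : Module.End ℂ Dist) (C : ℝ)
    (h : ∀ u : Sobolev s, ∃ z : lp (fun _ : ℤ => ℂ) 2,
      (∀ m, z m = weighted t (A (toDist s u)) m) ∧ ‖z‖ ≤ C * ‖u‖) :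
    ∃ L : Sobolev s →L[ℂ] Sobolev t, (∀ u, toDist t (L u) = A (toDist s u)) ∧
      ∀ u, ‖L u‖ ≤ C * ‖u‖ := by
  have h2 : ∀ u : Sobolev s, ∃ v : Sobolev t, toDist t v = A (toDist s u) ∧ ‖v‖ ≤ C * ‖u‖ := by
    intro u
    obtain ⟨z, hz, hn⟩ := h u
    have hz' : (z : ℤ → ℂ) = weighted t (A (toDist s u)) := funext hz
    have hm : A (toDist s u) ∈ LinearMap.range (toDist t) :=
      mem_range_toDist.2 ((memlp_weighted_iff t _).1 (hz' ▸ z.2))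
    obtain ⟨v, hv⟩ := hm
    refine ⟨v, hv, ?_⟩
    have : toL2 t v = z := by
      apply lp.ext
      funext m
      rw [toL2_apply, hv, hz]
    rw [norm_eq_norm_toL2, this]
    exact hn
  -- The lift is chosen pointwise; its linearity comes from the injectivity of `toDist`.
  choose f hf hn using h2
  let F : Sobolev s →ₗ[ℂ] Sobolev t :=
    { toFun := f
      map_add' := fun u v => toDist_injective t (by simp only [map_add, hf])
      map_smul' := fun c u => toDist_injective t (by simp only [map_smul, hf, RingHom.id_apply]) }
  exact ⟨F.mkContinuous C hn, hf, hn⟩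

/-- A sequence dominated by a shift of a square summable sequence is square summable. -/
theorem exists_lp_of_le_shift (x : lp (fun _ : ℤ => ℂ) 2) (z : ℤ → ℂ) {c : ℝ} (hc : 0 ≤ c) (k : ℤ)
    (h : ∀ m, ‖z m‖ ≤ c * ‖x (m - k)‖) :
    ∃ y : lp (fun _ : ℤ => ℂ) 2, (∀ m, y m = z m) ∧ ‖y‖ ≤ c * ‖x‖ := by
  have hp : 0 < (2 : ENNReal).toReal := by norm_num
  have hx := lp.hasSum_norm hp x
  have hs : HasSum (fun m => ‖x (m - k)‖ ^ (2 : ENNReal).toReal) (‖x‖ ^ (2 : ENNReal).toReal) :=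
    (Equiv.subRight k).hasSum_iff.2 hx
  have hs2 := hs.mul_left (c ^ (2 : ENNReal).toReal)
  have hle : ∀ m, ‖z m‖ ^ (2 : ENNReal).toReal ≤
      c ^ (2 : ENNReal).toReal * ‖x (m - k)‖ ^ (2 : ENNReal).toReal := fun m => by
    rw [← Real.mul_rpow hc (norm_nonneg _)]
    exact Real.rpow_le_rpow (norm_nonneg _) (h m) hp.le
  have hz : Summable fun m => ‖z m‖ ^ (2 : ENNReal).toReal :=
    Summable.of_nonneg_of_le (fun m => by positivity) hle hs2.summable
  refine ⟨⟨z, memℓp_gen hz⟩, fun m => rfl, ?_⟩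
  refine lp.norm_le_of_tsum_le hp (by positivity) ?_
  rw [Real.mul_rpow hc (norm_nonneg _), ← hs2.tsum_eq]
  exact hz.tsum_le_tsum hle hs2.summable

theorem norm_weighted (s : ℝ) (u : Dist) (m : ℤ) :
    ‖weighted s u m‖ = (1 + (m : ℝ) ^ 2) ^ (s / 2) * ‖fc u m‖ := by
  rw [weighted, norm_mul, Complex.norm_real, Real.norm_of_nonneg (by positivity)]

theorem one_le_one_add_sq (m : ℤ) : (1 : ℝ) ≤ 1 + (m : ℝ) ^ 2 := by nlinarith [sq_nonneg (m : ℝ)]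

/-- Fourier multipliers are bounded by the supremum of their weighted symbols. -/
theorem exists_lift_of_symbol {s t : ℝ} {A : Module.End ℂ Dist} {σ : ℤ → ℂ} {C : ℝ} (hC : 0 ≤ C)
    (hA : ∀ u m, fc (A u) m = σ m * fc u m)
    (hσ : ∀ m, ‖σ m‖ ≤ C * (1 + (m : ℝ) ^ 2) ^ ((s - t) / 2)) :
    ∃ L : Sobolev s →L[ℂ] Sobolev t, (∀ u, toDist t (L u) = A (toDist s u)) ∧
      ∀ u, ‖L u‖ ≤ C * ‖u‖ := by
  refine exists_lift A C fun u => ?_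
  refine exists_lp_of_le_shift (toL2 s u) (weighted t (A (toDist s u))) hC 0 fun m => ?_
  rw [sub_zero, toL2_apply, norm_weighted, norm_weighted, hA, norm_mul]
  have hm : (0 : ℝ) < 1 + (m : ℝ) ^ 2 := by positivity
  calc (1 + (m : ℝ) ^ 2) ^ (t / 2) * (‖σ m‖ * ‖fc (toDist s u) m‖)
      ≤ (1 + (m : ℝ) ^ 2) ^ (t / 2) * (C * (1 + (m : ℝ) ^ 2) ^ ((s - t) / 2) *
          ‖fc (toDist s u) m‖) := by gcongr; exact hσ m
    _ = C * ((1 + (m : ℝ) ^ 2) ^ (t / 2) * (1 + (m : ℝ) ^ 2) ^ ((s - t) / 2) *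
          ‖fc (toDist s u) m‖) := by ring
    _ = C * ((1 + (m : ℝ) ^ 2) ^ (s / 2) * ‖fc (toDist s u) m‖) := by
        rw [← Real.rpow_add hm]; congr 3; ring

theorem hasOrder_of_symbol {r : ℝ} {A : Module.End ℂ Dist} {σ : ℤ → ℂ} {C : ℝ}
    (hA : ∀ u m, fc (A u) m = σ m * fc u m)
    (hσ : ∀ m, ‖σ m‖ ≤ C * (1 + (m : ℝ) ^ 2) ^ (r / 2)) : HasOrder r A := by
  intro s t hst
  -- At m = 0 the weight is 1, so the hypothesis bounds a norm by `C`.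
  have hC : 0 ≤ C := by
    have h0 := (norm_nonneg _).trans (hσ 0)
    simpa using h0
  obtain ⟨L, hL, -⟩ := exists_lift_of_symbol (s := s) (t := t) hC hA fun m => (hσ m).trans (by
    have := one_le_one_add_sq m
    gcongr
    · linarith)
  exact ⟨L, hL⟩

/-- It suffices to bound a symbol outside a bounded set of frequencies. -/
theorem hasOrder_of_symbol_eventually {A : Module.End ℂ Dist} {σ : ℤ → ℂ} (r : ℝ) (N : ℤ) (C : ℝ)
    (hA : ∀ u m, fc (A u) m = σ m * fc u m)
    (hσ : ∀ m, N < |m| → ‖σ m‖ ≤ C * (1 + (m : ℝ) ^ 2) ^ (r / 2)) : HasOrder r A := by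
  have hO : σ =O[Filter.cofinite] fun m : ℤ => (1 + (m : ℝ) ^ 2) ^ (r / 2) := by
    refine Asymptotics.IsBigO.of_bound C ?_
    rw [Filter.eventually_cofinite]
    refine (Set.finite_Icc (-N) N).subset fun m hm => ?_
    by_contra h
    refine hm ?_
    rw [Real.norm_of_nonneg (by positivity)]
    refine hσ m (not_le.1 fun h2 => h (abs_le.1 h2))
  -- Because the weight never vanishes, a larger constant absorbs the finitely many exceptional
  -- frequencies.
  rw [Asymptotics.isBigO_cofinite_iff] at hO
  · obtain ⟨K, hK⟩ := hO
    refine hasOrder_of_symbol (C := K) hA fun m => ?_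
    have := hK m
    rwa [Real.norm_of_nonneg (by positivity)] at this
  · intro m hm
    have : (0 : ℝ) < (1 + (m : ℝ) ^ 2) ^ (r / 2) := by positivity
    exact absurd hm this.ne'

/-! ## Multiplication operators -/

/-- Peetre's inequality. -/
theorem peetre (σ : ℝ) (m k : ℤ) : (1 + (m : ℝ) ^ 2) ^ σ ≤
    (2 * (1 + (k : ℝ) ^ 2)) ^ |σ| * (1 + ((m - k : ℤ) : ℝ) ^ 2) ^ σ := by
  have hm : (0 : ℝ) < 1 + (m : ℝ) ^ 2 := by positivity
  have hmk : (0 : ℝ) < 1 + ((m - k : ℤ) : ℝ) ^ 2 := by positivity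
  rcases le_total 0 σ with h | h
  · rw [abs_of_nonneg h, ← Real.mul_rpow (by positivity) hmk.le]
    refine Real.rpow_le_rpow hm.le ?_ h
    push_cast
    -- The right side minus the left is 1 + (m-2k)² + 2(m-k)²k².
    nlinarith [sq_nonneg ((m : ℝ) - 2 * k), sq_nonneg (((m : ℝ) - k) * k)]
  · rw [abs_of_nonpos h]
    -- For a negative exponent, m and m - k exchange roles and the inequality is then inverted.
    have : (1 + ((m - k : ℤ) : ℝ) ^ 2) ^ (-σ) ≤
        (2 * (1 + (k : ℝ) ^ 2)) ^ (-σ) * (1 + (m : ℝ) ^ 2) ^ (-σ) := by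
      rw [← Real.mul_rpow (by positivity) hm.le]
      refine Real.rpow_le_rpow hmk.le ?_ (by linarith)
      push_cast
      nlinarith [sq_nonneg ((m : ℝ) + k), sq_nonneg ((m : ℝ) * k)]
    rw [Real.rpow_neg hmk.le, Real.rpow_neg hm.le, ← div_eq_mul_inv, inv_eq_one_div,
      div_le_div_iff₀ (by positivity) (by positivity), one_mul] at this
    exact this

/-- An operator given by an absolutely convergent series of shifts, with coefficients that grow
at most polynomially in the shift, is bounded on all Sobolev spaces. -/
theorem hasOrder_zero_of_hasSum {A : Module.End ℂ Dist} {b : ℤ → ℂ} {g : ℤ → ℤ → ℂ} {C : ℝ}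
    (hb : ∀ N : ℕ, Summable fun k : ℤ => (1 + (k : ℝ) ^ 2) ^ N * ‖b k‖)
    (hg : ∀ m k, ‖g m k‖ ≤ C * (1 + (k : ℝ) ^ 2))
    (hA : ∀ u m, HasSum (fun k => b k * g m k * fc u (m - k)) (fc (A u) m)) : HasOrder 0 A := by
  intro s t hst
  have hC : 0 ≤ C := by simpa using (norm_nonneg _).trans (hg 0 0)
  -- This bounds the norm of the k-th shift term: coefficient, growth of `g`, and the price of
  -- moving the weight from m to m - k by `peetre`.
  set c : ℤ → ℝ := fun k =>
    ‖b k‖ * (C * (1 + (k : ℝ) ^ 2)) * (2 * (1 + (k : ℝ) ^ 2)) ^ |s / 2| with hc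
  have hc0 : ∀ k, 0 ≤ c k := fun k => by positivity
  have hcs : Summable c := by
    set N := ⌈|s / 2|⌉₊ with hN
    refine Summable.of_nonneg_of_le hc0 (fun k => ?_) ((hb (N + 1)).mul_left (C * 2 ^ N))
    have h1 := one_le_one_add_sq k
    have h3 : 1 ≤ 2 * (1 + (k : ℝ) ^ 2) := by linarith
    have h2 : (2 * (1 + (k : ℝ) ^ 2)) ^ |s / 2| ≤ (2 * (1 + (k : ℝ) ^ 2)) ^ N :=
      (Real.rpow_le_rpow_of_exponent_le h3 (Nat.le_ceil _)).trans_eq (Real.rpow_natCast _ _)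
    calc c k ≤ ‖b k‖ * (C * (1 + (k : ℝ) ^ 2)) * (2 * (1 + (k : ℝ) ^ 2)) ^ N := by
          exact mul_le_mul_of_nonneg_left h2 (by positivity)
      _ = C * 2 ^ N * ((1 + (k : ℝ) ^ 2) ^ (N + 1) * ‖b k‖) := by rw [mul_pow]; ring
  obtain ⟨L, hL, -⟩ := exists_lift (s := s) (t := t) A (∑' k, c k) fun u => by
    have hz : ∀ k, ∃ y : lp (fun _ : ℤ => ℂ) 2,
        (∀ m, y m = (((1 + (m : ℝ) ^ 2) ^ (t / 2) : ℝ) : ℂ) *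
          (b k * g m k * fc (toDist s u) (m - k))) ∧ ‖y‖ ≤ c k * ‖toL2 s u‖ := fun k => by
      refine exists_lp_of_le_shift (toL2 s u) (fun m => (((1 + (m : ℝ) ^ 2) ^ (t / 2) : ℝ) : ℂ) *
          (b k * g m k * fc (toDist s u) (m - k))) (hc0 k) k fun m => ?_
      rw [toL2_apply, norm_weighted, norm_mul, norm_mul, norm_mul, Complex.norm_real,
        Real.norm_of_nonneg (by positivity)]
      have h1 := one_le_one_add_sq m
      have h2 : (1 + (m : ℝ) ^ 2) ^ (t / 2) ≤ (1 + (m : ℝ) ^ 2) ^ (s / 2) :=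
        Real.rpow_le_rpow_of_exponent_le h1 (by linarith)
      calc (1 + (m : ℝ) ^ 2) ^ (t / 2) * (‖b k‖ * ‖g m k‖ * ‖fc (toDist s u) (m - k)‖)
          ≤ ((2 * (1 + (k : ℝ) ^ 2)) ^ |s / 2| * (1 + ((m - k : ℤ) : ℝ) ^ 2) ^ (s / 2)) *
            (‖b k‖ * (C * (1 + (k : ℝ) ^ 2)) * ‖fc (toDist s u) (m - k)‖) := by
            gcongr
            · exact h2.trans (peetre _ _ _)
            · exact hg m k
        _ = _ := by rw [hc]; ring
    choose y hy hyn using hz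
    -- The series of shifts converges absolutely in ℓ². Evaluating coordinates, which is continuous,
    -- identifies its sum.
    have hys : Summable y := Summable.of_norm_bounded (hcs.mul_right _) hyn
    refine ⟨∑' k, y k, fun m => ?_, ?_⟩
    · have h1 : HasSum (fun k => y k m) ((∑' k, y k : lp (fun _ : ℤ => ℂ) 2) m) :=
        hys.hasSum.map (lp.evalCLM ℂ (fun _ : ℤ => ℂ) 2 m) (lp.evalCLM ℂ (fun _ : ℤ => ℂ) 2 m).continuous
      simp only [hy] at h1
      exact h1.unique ((hA (toDist s u) m).mul_left _)
    · rw [← tsum_mul_right]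
      exact tsum_of_norm_bounded (hcs.mul_right _).hasSum hyn
  exact ⟨L, hL⟩

/-! ### Rapid decay of Fourier coefficients, multiplication and its commutator with T₀. -/

/-- The operator `1 - d²/dt²` on test functions, with symbol `1 + m²`. -/
def bessel : Test →L[ℂ] Test := ContinuousLinearMap.id ℂ Test - DL.comp DL

theorem coef_bessel (φ : Test) (m : ℤ) : coef (bessel φ) m = (1 + (m : ℂ) ^ 2) * coef φ m := by
  have hsub : coef (φ - D (D φ)) m = coef φ m - coef (D (D φ)) m := by
    rw [coef, coef, coef, ← mul_sub]
    have hi := intervalIntegral.integral_sub (a := 0) (b := 2 * π) (μ := MeasureTheory.volume)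
      (f := fun t => φ t * expo (-m) t) (g := fun t => D (D φ) t * expo (-m) t)
      ((φ.continuous.mul (Test.continuous _)).intervalIntegrable _ _)
      (((Test.continuous _).mul (Test.continuous _)).intervalIntegrable _ _)
    rw [← hi]
    congr 1
    refine intervalIntegral.integral_congr fun t _ => ?_
    change (φ t - D (D φ) t) * _ = _
    ring
  change coef (φ - D (D φ)) m = _
  rw [hsub, coef_D, coef_D]
  linear_combination -(m : ℂ) ^ 2 * coef φ m * Complex.I_sq

theorem coef_bessel_pow (N : ℕ) (φ : Test) (m : ℤ) :
    coef ((bessel ^ N) φ) m = (1 + (m : ℂ) ^ 2) ^ N * coef φ m := by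
  induction N generalizing φ with
  | zero => simp
  | succ N ih =>
    rw [pow_succ]
    change coef ((bessel ^ N) (bessel φ)) m = _
    rw [ih, coef_bessel]; ring

/-- The weighted coefficients are those of `(bessel ^ N) a`, which is again smooth, so
`summable_coef` applies to it. -/
theorem summable_coef_mul_pow (a : Test) (N : ℕ) :
    Summable fun k : ℤ => (1 + (k : ℝ) ^ 2) ^ N * ‖coef a k‖ := by
  refine (summable_coef ((bessel ^ N) a)).norm.congr fun k => ?_
  have : (1 + (k : ℂ) ^ 2) ^ N = (((1 + (k : ℝ) ^ 2) ^ N : ℝ) : ℂ) := by push_cast; rfl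
  rw [coef_bessel_pow, norm_mul, this, Complex.norm_real, Real.norm_of_nonneg (by positivity)]

/-- The Fourier series of `a` converges in the topology of test functions, so multiplication by
e^{-imt} and then `u` may be applied term by term. -/
theorem hasSum_fc_mulD (a : Test) (u : Dist) (m : ℤ) :
    HasSum (fun k => coef a k * fc u (m - k)) (fc (mulD a u) m) := by
  have h := (((hasSum_coef a).mapL (mulTestL (expo (-m)))).mapL u).mul_left (1 / (2 * π) : ℂ)
  have e : mulTestL (expo (-m)) a = mulTestL a (expo (-m)) := Test.ext fun t => mul_comm _ _
  rw [e] at h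
  refine HasSum.congr_fun (f := fun k => _) h fun k => ?_
  have e2 : mulTestL (expo (-m)) (expo k) = expo (-(m - k)) := Test.ext fun t => by
    change expo (-m) t * expo k t = _
    rw [expo_mul_expo]
    congr 2; ring
  rw [map_smul, e2, map_smul, fc, smul_eq_mul]
  ring

theorem hasOrder_mulD (a : Test) : HasOrder 0 (mulD a) := by
  refine hasOrder_zero_of_hasSum (b := coef a) (g := fun _ _ => 1) (C := 1)
    (summable_coef_mul_pow a) (fun m k => ?_) fun u m => ?_
  · rw [norm_one, one_mul]
    exact one_le_one_add_sq k
  · simpa using hasSum_fc_mulD a u m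

theorem fc_sub (u v : Dist) (m : ℤ) : fc (u - v) m = fc u m - fc v m := by
  simp [fc, mul_sub]

/-- The k-th shift carries the difference of the symbol of T₀ at m and at m - k. Its modulus is at
most |k| + 2 ≤ 3(1 + k²), uniformly in m, so the first-order growth in m is gone and the growth in k
is absorbed by the decay of the coefficients of `a`. -/
theorem hasOrder_commutator (a : Test) : HasOrder 0 (T0 * mulD a - mulD a * T0) := by
  refine hasOrder_zero_of_hasSum (b := coef a) (g := fun m k => symT0 m - symT0 (m - k)) (C := 3)
    (summable_coef_mul_pow a) (fun m k => ?_) fun u m => ?_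
  · have h1 : ‖(-((|m| : ℤ) : ℂ) + ((|m - k| : ℤ) : ℂ))‖ ≤ |(k : ℝ)| := by
      have : (-((|m| : ℤ) : ℂ) + ((|m - k| : ℤ) : ℂ)) = (((|m - k| - |m| : ℤ) : ℝ) : ℂ) := by
        rw [neg_add_eq_sub, Complex.ofReal_intCast, Int.cast_sub]
      rw [this, Complex.norm_real, Real.norm_eq_abs]
      push_cast
      refine (abs_abs_sub_abs_le _ _).trans (le_of_eq ?_)
      rw [sub_sub_cancel_left, abs_neg]
    have h2 : ∀ n : ℤ, ‖(if n = 0 then Complex.I else 0 : ℂ)‖ ≤ 1 := fun n => by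
      split_ifs <;> simp
    have e : symT0 m - symT0 (m - k) = (-((|m| : ℤ) : ℂ) + ((|m - k| : ℤ) : ℂ)) +
        ((if m = 0 then Complex.I else 0) - (if m - k = 0 then Complex.I else 0)) := by
      rw [symT0, symT0]; ring
    rw [e]
    calc _ ≤ |(k : ℝ)| + (1 + 1) := (norm_add_le _ _).trans
          (add_le_add h1 ((norm_sub_le _ _).trans (add_le_add (h2 _) (h2 _))))
      _ ≤ 3 * (1 + (k : ℝ) ^ 2) := by
        nlinarith [sq_nonneg (|(k : ℝ)| - 1), sq_abs (k : ℝ), sq_nonneg (k : ℝ)]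
  · change HasSum _ (fc (T0 (mulD a u) - mulD a (T0 u)) m)
    rw [fc_sub, fc_T0]
    have h := ((hasSum_fc_mulD a u m).mul_left (symT0 m)).sub (hasSum_fc_mulD a (T0 u) m)
    refine HasSum.congr_fun (f := fun k => _) h fun k => ?_
    rw [fc_T0]
    ring

/-! ## Completeness of the Sobolev spaces -/

/-- The functional `f ↦ ∫_0^{2π} f(t) e^{imt} dt` on bounded continuous functions. -/
def integralExpo (m : ℤ) : BoundedContinuousFunction ℝ ℂ →L[ℂ] ℂ :=
  LinearMap.mkContinuous
    { toFun := fun f => ∫ t in (0 : ℝ)..2 * π, f t * expo m t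
      map_add' := fun f g => by
        simp only [BoundedContinuousFunction.add_apply, add_mul]
        exact intervalIntegral.integral_add
          ((f.continuous.mul (Test.continuous _)).intervalIntegrable _ _)
          ((g.continuous.mul (Test.continuous _)).intervalIntegrable _ _)
      map_smul' := fun c f => by
        simp only [BoundedContinuousFunction.coe_smul, smul_eq_mul, mul_assoc, RingHom.id_apply]
        exact intervalIntegral.integral_const_mul _ _ } (2 * π) fun f => by
    have h := intervalIntegral.norm_integral_le_of_norm_le_const (a := 0) (b := 2 * π)
      (f := fun t => f t * expo m t) (C := ‖f‖) fun t _ => by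
        rw [norm_mul, norm_expo, mul_one]; exact f.norm_coe_le_norm t
    rw [sub_zero, abs_of_pos Real.two_pi_pos, mul_comm ‖f‖] at h
    exact h

theorem integralExpo_apply (m : ℤ) (f : BoundedContinuousFunction ℝ ℂ) :
    integralExpo m f = ∫ t in (0 : ℝ)..2 * π, f t * expo m t := rfl

theorem norm_integralExpo_le (m : ℤ) : ‖integralExpo m‖ ≤ 2 * π :=
  LinearMap.mkContinuous_norm_le _ Real.two_pi_pos.le _

theorem bessel_pow_expo (N : ℕ) (m : ℤ) :
    (bessel ^ N) (expo m) = ((1 + (m : ℂ) ^ 2) ^ N) • expo m := by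
  have h1 : bessel (expo m) = (1 + (m : ℂ) ^ 2) • expo m := by
    change expo m - D (D (expo m)) = _
    rw [D_expo, map_smul, D_expo, smul_smul]
    nth_rw 1 [← one_smul ℂ (expo m)]
    rw [← sub_smul]
    congr 1
    linear_combination -(m : ℂ) ^ 2 * Complex.I_sq
  induction N with
  | zero => simp
  | succ N ih =>
    rw [pow_succ']
    change bessel ((bessel ^ N) (expo m)) = _
    rw [ih, map_smul, h1, smul_smul, ← pow_succ]

/-- Every sequence of polynomial growth is the sequence of Fourier coefficients of a periodic
distribution. -/
theorem exists_fc_eq (c : ℤ → ℂ) (N : ℕ)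
    (hc : Summable fun m : ℤ => ‖c m‖ * ((1 + (m : ℝ) ^ 2) ^ N)⁻¹) : ∃ u : Dist, fc u = c := by
  set b : ℤ → ℂ := fun m => c m * ((1 + (m : ℂ) ^ 2) ^ N)⁻¹ with hb
  have hcast : ∀ m : ℤ, (1 + (m : ℂ) ^ 2) ^ N = (((1 + (m : ℝ) ^ 2) ^ N : ℝ) : ℂ) := fun m => by
    push_cast; rfl
  have hbn : ∀ m, ‖b m‖ = ‖c m‖ * ((1 + (m : ℝ) ^ 2) ^ N)⁻¹ := fun m => by
    rw [hb, norm_mul, norm_inv, hcast, Complex.norm_real, Real.norm_of_nonneg (by positivity)]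
  have hs : Summable fun m => b m • integralExpo m := by
    refine Summable.of_norm_bounded (hc.mul_right (2 * π)) fun m => ?_
    rw [norm_smul, hbn]
    exact mul_le_mul_of_nonneg_left (norm_integralExpo_le m) (by positivity)
  -- Dividing by (1 + m²)^N makes the series converge in norm on bounded functions; applying (1 -
  -- d²/dt²)^N to the test function restores the factor.
  let u : Dist := (∑' m, b m • integralExpo m).comp ((⟨toBCF, continuous_toBCF⟩ : Test →L[ℂ] _).comp
    (bessel ^ N))
  refine ⟨u, funext fun n => ?_⟩
  have h1 : u (expo (-n)) = (1 + (n : ℂ) ^ 2) ^ N *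
      (∑' m, b m • integralExpo m) (toBCF (expo (-n))) := by
    change (∑' m, b m • integralExpo m) (toBCF ((bessel ^ N) (expo (-n)))) = _
    rw [bessel_pow_expo, map_smul, map_smul, smul_eq_mul]
    push_cast
    rw [neg_sq]
  have h2 : HasSum (fun m => b m * integralExpo m (toBCF (expo (-n))))
      ((∑' m, b m • integralExpo m) (toBCF (expo (-n)))) :=
    hs.hasSum.map (ContinuousLinearMap.apply ℂ ℂ (toBCF (expo (-n))))
      (ContinuousLinearMap.apply ℂ ℂ (toBCF (expo (-n)))).continuous
  have h3 : ∀ m, integralExpo m (toBCF (expo (-n))) = if m = n then (2 * π : ℂ) else 0 := fun m => by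
    simp only [integralExpo_apply, toBCF_apply, expo_mul_expo]
    rw [integral_expo]
    simp only [neg_add_eq_zero, eq_comm (a := n)]
  have h4 : (∑' m, b m • integralExpo m) (toBCF (expo (-n))) = b n * (2 * π) := by
    refine h2.unique ?_
    have := hasSum_ite_eq n (b n * (2 * π))
    refine HasSum.congr_fun this fun m => ?_
    rw [h3]
    split_ifs with h
    · rw [h]
    · simp
  have hne : (1 + (n : ℂ) ^ 2) ^ N ≠ 0 := by
    rw [hcast]
    exact Complex.ofReal_ne_zero.2 (by positivity)
  have := pi_ne_zero_complex
  rw [fc, h1, h4, hb]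
  field_simp

theorem summable_inv_one_add_sq : Summable fun m : ℤ => (1 + (m : ℝ) ^ 2)⁻¹ := by
  refine Summable.of_norm_bounded_eventually
    ((Real.summable_one_div_int_pow (p := 2)).2 (by norm_num)) ?_
  rw [Filter.eventually_cofinite]
  refine (Set.finite_singleton (0 : ℤ)).subset fun m hm => ?_
  by_contra h0
  have h0 : m ≠ 0 := h0
  refine hm ?_
  have : (0 : ℝ) < (m : ℝ) ^ 2 := by positivity
  rw [Real.norm_of_nonneg (by positivity), one_div]
  gcongr
  linarith

/-- An ℓ² sequence is bounded, so removing the weight leaves a sequence of polynomial growth, which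
`exists_fc_eq` realizes by a distribution. -/
theorem toL2_surjective (s : ℝ) : Function.Surjective (toL2 s) := by
  intro x
  set c : ℤ → ℂ := fun m => (((1 + (m : ℝ) ^ 2) ^ (-(s / 2)) : ℝ) : ℂ) * x m with hc
  -- With this choice -s/2 - N ≤ -1, and Σ (1 + m²)⁻¹ converges.
  set N := ⌈1 - s / 2⌉₊ with hN
  obtain ⟨u, hu⟩ := exists_fc_eq c N (by
    refine Summable.of_nonneg_of_le (fun m => by positivity) (fun m => ?_)
      (summable_inv_one_add_sq.mul_left ‖x‖)
    have hm : (0 : ℝ) < 1 + (m : ℝ) ^ 2 := by positivity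
    have hx : ‖x m‖ ≤ ‖x‖ := lp.norm_apply_le_norm (by norm_num) x m
    rw [hc, norm_mul, Complex.norm_real, Real.norm_of_nonneg (by positivity)]
    have he : (1 + (m : ℝ) ^ 2) ^ (-(s / 2)) * ((1 + (m : ℝ) ^ 2) ^ N)⁻¹ ≤
        (1 + (m : ℝ) ^ 2)⁻¹ := by
      rw [← Real.rpow_natCast _ N, ← Real.rpow_neg hm.le, ← Real.rpow_add hm, ← Real.rpow_neg_one]
      refine Real.rpow_le_rpow_of_exponent_le (one_le_one_add_sq m) ?_
      have := Nat.le_ceil (1 - s / 2)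
      linarith
    calc _ = ‖x m‖ * ((1 + (m : ℝ) ^ 2) ^ (-(s / 2)) * ((1 + (m : ℝ) ^ 2) ^ N)⁻¹) := by ring
      _ ≤ _ := mul_le_mul hx he (by positivity) (norm_nonneg _))
  have hw : weighted s u = x := by
    funext m
    have hm : (0 : ℝ) < 1 + (m : ℝ) ^ 2 := by positivity
    rw [weighted, hu, hc, ← mul_assoc, ← Complex.ofReal_mul, ← Real.rpow_add hm, add_neg_cancel,
      Real.rpow_zero, Complex.ofReal_one, one_mul]
  obtain ⟨v, hv⟩ := mem_range_toDist.2 ((memlp_weighted_iff s u).1 (hw ▸ x.2))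
  refine ⟨v, lp.ext ?_⟩
  change weighted s (toDist s v) = _
  rw [hv, hw]

/-- The space `H^s` is isometric to `ℓ²`. -/
def equivL2 (s : ℝ) : Sobolev s ≃ₗᵢ[ℂ] lp (fun _ : ℤ => ℂ) 2 :=
  LinearIsometryEquiv.ofSurjective ⟨toL2 s, fun _ => rfl⟩ (toL2_surjective s)

/-- Completeness of the target is what makes a norm limit of compact operators compact in
`exists_compact_inclusion`. -/
instance instCompleteSpaceSobolev (s : ℝ) : CompleteSpace (Sobolev s) :=
  (equivL2 s).toIsometryEquiv.completeSpace

/-! ## Compactness of operators of lower order -/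

/-- A Fourier coefficient as a continuous functional on `H^s`. -/
def fcL (s : ℝ) (m : ℤ) : Sobolev s →L[ℂ] ℂ :=
  (((1 + (m : ℝ) ^ 2) ^ (-(s / 2)) : ℝ) : ℂ) •
    (lp.evalCLM ℂ (fun _ : ℤ => ℂ) 2 m).comp (equivL2 s).toContinuousLinearEquiv.toContinuousLinearMap

theorem fcL_apply (s : ℝ) (m : ℤ) (u : Sobolev s) : fcL s m u = fc (toDist s u) m := by
  change (((1 + (m : ℝ) ^ 2) ^ (-(s / 2)) : ℝ) : ℂ) * weighted s (toDist s u) m = _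
  have hm : (0 : ℝ) < 1 + (m : ℝ) ^ 2 := by positivity
  rw [weighted, ← mul_assoc, ← Complex.ofReal_mul, ← Real.rpow_add hm, neg_add_cancel,
    Real.rpow_zero, Complex.ofReal_one, one_mul]

theorem fc_ofTest_expo (m n : ℤ) : fc (ofTest (expo m)) n = if n = m then 1 else 0 := by
  have := pi_ne_zero_complex
  rw [fc_ofTest, coef]
  simp only [expo_mul_expo]
  rw [integral_expo]
  simp only [add_neg_eq_zero, eq_comm (a := m)]
  split_ifs
  · field_simp
  · simp

theorem fc_sum (s : Finset ℤ) (f : ℤ → Dist) (n : ℤ) :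
    fc (∑ m ∈ s, f m) n = ∑ m ∈ s, fc (f m) n := by
  simp [fc, Finset.mul_sum]

theorem exists_toDist_eq_expo (s : ℝ) (m : ℤ) : ∃ e : Sobolev s, toDist s e = ofTest (expo m) := by
  refine mem_range_toDist.2 (summable_of_ne_finset_zero (s := {m}) fun n hn => ?_)
  rw [fc_ofTest_expo, if_neg (by simpa using hn)]
  simp

/-- The projection to the frequencies in `s`. -/
def freqProj (s : Finset ℤ) : Module.End ℂ Dist :=
  ∑ m ∈ s, LinearMap.smulRight
    ({ toFun := fun u => fc u m, map_add' := fun u v => fc_add u v m,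
       map_smul' := fun c u => fc_smul c u m } : Dist →ₗ[ℂ] ℂ) (ofTest (expo m))

theorem freqProj_apply (s : Finset ℤ) (u : Dist) :
    freqProj s u = ∑ m ∈ s, fc u m • ofTest (expo m) := by
  rw [freqProj, LinearMap.sum_apply]
  rfl

theorem fc_one_sub_freqProj (s : Finset ℤ) (u : Dist) (n : ℤ) :
    fc ((1 - freqProj s) u) n = (if n ∈ s then 0 else 1) * fc u n := by
  change fc (u - freqProj s u) n = _
  rw [fc_sub, freqProj_apply, fc_sum]
  simp only [fc_smul, fc_ofTest_expo, mul_ite, mul_one, mul_zero, Finset.sum_ite_eq]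
  split_ifs <;> simp

/-- The embedding of `H^s` in `H^t` is compact for `t < s`. -/
theorem exists_compact_inclusion {s t : ℝ} (hst : t < s) : ∃ J : Sobolev s →L[ℂ] Sobolev t,
    (∀ u, toDist t (J u) = toDist s u) ∧ IsCompactOperator J := by
  obtain ⟨J, hJ, -⟩ := exists_lift_of_symbol (s := s) (t := t) (A := 1) (σ := fun _ => 1) (C := 1)
    zero_le_one (fun u m => (one_mul _).symm) fun m => by
      rw [norm_one, one_mul]
      exact Real.one_le_rpow (one_le_one_add_sq m) (by linarith)
  refine ⟨J, hJ, ?_⟩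
  choose e he using exists_toDist_eq_expo t
  -- Truncations to the frequencies |m| ≤ N have finite rank and are therefore compact.
  set F : ℕ → Sobolev s →L[ℂ] Sobolev t := fun N =>
    ∑ m ∈ Finset.Icc (-(N : ℤ)) N, (fcL s m).smulRight (e m) with hF
  have hFd : ∀ N u, toDist t (F N u) = freqProj (Finset.Icc (-(N : ℤ)) N) (toDist s u) := by
    intro N u
    rw [freqProj_apply, hF]
    simp only [sum_apply, map_sum, ContinuousLinearMap.smulRight_apply,
      map_smul, he, fcL_apply]
  have hFc : ∀ N, IsCompactOperator (F N) := by
    intro N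
    refine Submodule.sum_mem (compactOperator (RingHom.id ℂ) (Sobolev s) (Sobolev t)) fun m _ => ?_
    exact (isCompactOperator_of_locallyCompactSpace_dom (fcL s m)).clm_comp
      (ContinuousLinearMap.toSpanSingleton ℂ (e m))
  -- The error is the multiplier with symbol 1 on |m| > N, where the ratio of the two weights is at
  -- most this bound; it tends to 0 because t < s.
  have hn : ∀ N, ‖F N - J‖ ≤ (1 + (N : ℝ) ^ 2) ^ (-((s - t) / 2)) := by
    intro N
    obtain ⟨L, hL, hLn⟩ := exists_lift_of_symbol (s := s) (t := t)
      (C := (1 + (N : ℝ) ^ 2) ^ (-((s - t) / 2))) (by positivity)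
      (fc_one_sub_freqProj (Finset.Icc (-(N : ℤ)) N)) fun m => by
        split_ifs with hm
        · rw [norm_zero]; positivity
        · rw [norm_one, Real.rpow_neg (by positivity), inv_mul_eq_div, one_le_div (by positivity)]
          have : (N : ℤ) ≤ |m| := by
            rw [Finset.mem_Icc, ← abs_le, not_le] at hm
            exact hm.le
          have h2 : (N : ℝ) ≤ |(m : ℝ)| := by exact_mod_cast this
          refine Real.rpow_le_rpow (by positivity) ?_ (by linarith)
          rw [← sq_abs (m : ℝ)]
          gcongr
    have hFJ : F N - J = -L := by
      ext u
      refine toDist_injective t ?_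
      change toDist t (F N u - J u) = toDist t (-(L u))
      rw [map_sub, hFd, hJ, map_neg, hL]
      change _ = -(toDist s u - _)
      rw [neg_sub]
      rfl
    rw [hFJ, norm_neg]
    exact L.opNorm_le_bound (by positivity) hLn
  have hlim : Filter.Tendsto F Filter.atTop (𝓝 J) := by
    rw [tendsto_iff_norm_sub_tendsto_zero]
    refine squeeze_zero (fun _ => norm_nonneg _) hn ?_
    refine (tendsto_rpow_neg_atTop (by linarith : 0 < (s - t) / 2)).comp ?_
    refine Filter.tendsto_atTop_mono (fun N => ?_) tendsto_natCast_atTop_atTop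
    nlinarith [sq_nonneg ((N : ℝ) - 1)]
  exact isCompactOperator_of_tendsto hlim (Filter.Eventually.of_forall hFc)

/-- An operator of order `r` is compact from `H^s` to `H^t` for `t < s - r`. -/
theorem HasOrder.exists_compact_lift {r s t : ℝ} {A : Module.End ℂ Dist} (hA : HasOrder r A)
    (hst : t + r < s) : ∃ L : Sobolev s →L[ℂ] Sobolev t,
      (∀ u, toDist t (L u) = A (toDist s u)) ∧ IsCompactOperator L := by
  obtain ⟨J, hJ, hJc⟩ := exists_compact_inclusion hst
  obtain ⟨L, hL⟩ := hA (t + r) t le_rfl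
  exact ⟨L.comp J, fun u => (hL _).trans (congrArg A (hJ u)), hJc.clm_comp L⟩

/-- The ring structure on the operators on distributions, with the negation and subtraction of
linear maps. -/
instance instRingEndDist : Ring (Module.End ℂ Dist) :=
  { (inferInstance : AddCommGroup (Module.End ℂ Dist)),
    (inferInstance : Semiring (Module.End ℂ Dist)) with
    intCast := Int.castDef
    intCast_ofNat := fun _ => rfl
    intCast_negSucc := fun _ => rfl }

/-! ## Orders of the operators -/

/-- For |m| ≥ 1, 1 + m² ≤ (2|m|)², so replacing the Sobolev weight by |m|^j costs a factor 2^j. -/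
theorem hasOrder_neg_of_decay {A : Module.End ℂ Dist} {σ : ℤ → ℂ} (j : ℕ) {N : ℤ} (hN : 0 ≤ N)
    (C : ℝ) (hA : ∀ u m, fc (A u) m = σ m * fc u m)
    (hσ : ∀ m, N < |m| → ‖σ m‖ * |(m : ℝ)| ^ j ≤ C) : HasOrder (-j) A := by
  refine hasOrder_of_symbol_eventually (-j) N (C * 2 ^ j) hA fun m hm => ?_
  have hm0 : (0 : ℝ) < 1 + (m : ℝ) ^ 2 := by positivity
  have hm1 : (1 : ℝ) ≤ |(m : ℝ)| := by exact_mod_cast (by omega : (1 : ℤ) ≤ |m|)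
  have h1 : (1 + (m : ℝ) ^ 2) ^ ((j : ℝ) / 2) ≤ 2 ^ j * |(m : ℝ)| ^ j := by
    have h2 : 1 + (m : ℝ) ^ 2 ≤ (2 * |(m : ℝ)|) ^ (2 : ℝ) := by
      rw [Real.rpow_two, ← sq_abs (m : ℝ)]
      nlinarith
    calc (1 + (m : ℝ) ^ 2) ^ ((j : ℝ) / 2)
        ≤ ((2 * |(m : ℝ)|) ^ (2 : ℝ)) ^ ((j : ℝ) / 2) :=
          Real.rpow_le_rpow hm0.le h2 (by positivity)
      _ = 2 ^ j * |(m : ℝ)| ^ j := by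
          rw [← Real.rpow_mul (by positivity), mul_div_cancel₀ _ (by norm_num : (2 : ℝ) ≠ 0),
            Real.rpow_natCast, mul_pow]
  rw [neg_div, Real.rpow_neg hm0.le, ← div_eq_mul_inv, le_div_iff₀ (by positivity)]
  calc ‖σ m‖ * (1 + (m : ℝ) ^ 2) ^ ((j : ℝ) / 2) ≤ ‖σ m‖ * (2 ^ j * |(m : ℝ)| ^ j) := by gcongr
    _ = ‖σ m‖ * |(m : ℝ)| ^ j * 2 ^ j := by ring
    _ ≤ C * 2 ^ j := by gcongr; exact hσ m hm

theorem symS0_of_ne_zero {m : ℤ} (hm : m ≠ 0) : symS0 m = ((|(m : ℝ)|⁻¹ : ℝ) : ℂ) := by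
  rw [symS0, if_neg hm, add_zero, ← Int.cast_abs, Complex.ofReal_inv, Complex.ofReal_intCast]

theorem symT0_of_ne_zero {m : ℤ} (hm : m ≠ 0) : symT0 m = ((-|(m : ℝ)| : ℝ) : ℂ) := by
  rw [symT0, if_neg hm, add_zero, ← Int.cast_abs, Complex.ofReal_neg, Complex.ofReal_intCast]

/-- The difference of 1/|m| gains one power: 1/(n-1) - 1/(n+1) = 2/(n²-1) for n > 1. The symbol is
odd, and its norm lets negative m be reduced to -m. -/
theorem norm_symS1 {m : ℤ} (hm : 1 < |m|) : ‖symS1 m‖ = 1 / (2 * (|(m : ℝ)| ^ 2 - 1)) := by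
  have key : ∀ n : ℤ, 1 < n → ((|n - 1| : ℤ) : ℂ)⁻¹ - ((|n + 1| : ℤ) : ℂ)⁻¹ =
      ((2 / ((n : ℝ) ^ 2 - 1) : ℝ) : ℂ) := fun n hn => by
    rw [abs_of_pos (by omega : 0 < n - 1), abs_of_pos (by omega : 0 < n + 1)]
    have h1 : ((n : ℂ) - 1) ≠ 0 := by exact_mod_cast (by omega : n - 1 ≠ 0)
    have h2 : ((n : ℂ) + 1) ≠ 0 := by exact_mod_cast (by omega : n + 1 ≠ 0)
    have h3 : ((n : ℂ) ^ 2 - 1) ≠ 0 := by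
      rw [show (n : ℂ) ^ 2 - 1 = (n - 1) * (n + 1) by ring]
      exact mul_ne_zero h1 h2
    push_cast
    field_simp
    ring
  have hx : (1 : ℝ) < |(m : ℝ)| := by exact_mod_cast hm
  have hpos : 0 < |(m : ℝ)| ^ 2 - 1 := by nlinarith
  have hnorm : ‖((|m - 1| : ℤ) : ℂ)⁻¹ - ((|m + 1| : ℤ) : ℂ)⁻¹‖ = 2 / (|(m : ℝ)| ^ 2 - 1) := by
    rcases le_total 0 m with h | h
    · rw [abs_of_nonneg h] at hm
      rw [key m hm, Complex.norm_real, Real.norm_of_nonneg, sq_abs]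
      rw [sq_abs] at hpos
      positivity
    · have h2 := key (-m) (by rwa [abs_of_nonpos h] at hm)
      rw [show |m - 1| = |-m + 1| by rw [← abs_neg]; congr 1; ring,
        show |m + 1| = |-m - 1| by rw [← abs_neg]; congr 1; ring, norm_sub_rev, h2,
        Complex.norm_real, Real.norm_of_nonneg, sq_abs]
      · push_cast; rw [neg_sq]
      · push_cast
        rw [neg_sq, ← sq_abs]
        positivity
  rw [symS1, norm_mul, hnorm]
  simp only [norm_div, Complex.norm_I, Complex.norm_ofNat]
  field_simp
  norm_num

/-- The second difference of 1/|m| gains two powers: 2/n - 1/(n-2) - 1/(n+2) = -8/(n(n²-4)) for n >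
2. The symbol is even. -/
theorem symS2_eq {m : ℤ} (hm : 2 < |m|) :
    symS2 m = ((-(1 / (2 * |(m : ℝ)| * (|(m : ℝ)| ^ 2 - 4))) : ℝ) : ℂ) := by
  have key : ∀ n : ℤ, 2 < n →
      symS2 n = ((-(1 / (2 * (n : ℝ) * ((n : ℝ) ^ 2 - 4))) : ℝ) : ℂ) := fun n hn => by
    rw [symS2, abs_of_pos (by omega : 0 < n), abs_of_pos (by omega : 0 < n - 2),
      abs_of_pos (by omega : 0 < n + 2)]
    have h0 : (n : ℂ) ≠ 0 := by exact_mod_cast (by omega : n ≠ 0)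
    have h1 : ((n : ℂ) - 2) ≠ 0 := by exact_mod_cast (by omega : n - 2 ≠ 0)
    have h2 : ((n : ℂ) + 2) ≠ 0 := by exact_mod_cast (by omega : n + 2 ≠ 0)
    have h3 : ((n : ℂ) ^ 2 - 4) ≠ 0 := by
      rw [show (n : ℂ) ^ 2 - 4 = (n - 2) * (n + 2) by ring]
      exact mul_ne_zero h1 h2
    push_cast
    field_simp
    ring
  have h := key |m| hm
  rw [Int.cast_abs] at h
  rw [← h]
  rcases le_total 0 m with h | h
  · rw [abs_of_nonneg h]
  · rw [abs_of_nonpos h, symS2, symS2, abs_neg,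
      show |m - 2| = |-m + 2| by rw [← abs_neg]; congr 1; ring,
      show |m + 2| = |-m - 2| by rw [← abs_neg]; congr 1; ring]
    ring

theorem hasOrder_S0 : HasOrder (-1) S0 := by
  have := hasOrder_neg_of_decay 1 le_rfl 1 fc_S0 fun m hm => by
    have h : |(m : ℝ)| ≠ 0 := by
      have : m ≠ 0 := abs_pos.1 hm
      simpa using this
    rw [symS0_of_ne_zero (abs_pos.1 hm), Complex.norm_real, norm_inv, Real.norm_eq_abs, abs_abs,
      pow_one, inv_mul_cancel₀ h]
  simpa using this

theorem hasOrder_T0 : HasOrder 1 T0 := by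
  refine hasOrder_of_symbol_eventually 1 0 1 fc_T0 fun m hm => ?_
  rw [symT0_of_ne_zero (abs_pos.1 hm), Complex.norm_real, norm_neg, Real.norm_eq_abs, abs_abs,
    one_mul, ← Real.sqrt_eq_rpow]
  exact Real.abs_le_sqrt (by linarith)

theorem hasOrder_S1 : HasOrder (-2) S1 := by
  have := hasOrder_neg_of_decay 2 zero_le_one 1 fc_S1 fun m hm => by
    have hx : (2 : ℝ) ≤ |(m : ℝ)| := by exact_mod_cast (by omega : (2 : ℤ) ≤ |m|)
    have : 0 < |(m : ℝ)| ^ 2 - 1 := by nlinarith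
    rw [norm_symS1 hm, div_mul_eq_mul_div, one_mul, div_le_one (by positivity)]
    nlinarith
  simpa using this

theorem hasOrder_S2 : HasOrder (-3) S2 := by
  have := hasOrder_neg_of_decay 3 zero_le_two 1 fc_S2 fun m hm => by
    have hx : (3 : ℝ) ≤ |(m : ℝ)| := by exact_mod_cast (by omega : (3 : ℤ) ≤ |m|)
    have : 0 < |(m : ℝ)| ^ 2 - 4 := by nlinarith
    rw [symS2_eq hm, Complex.norm_real, norm_neg, Real.norm_of_nonneg (by positivity),
      div_mul_eq_mul_div, one_mul, div_le_one (by positivity)]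
    nlinarith [mul_nonneg (by linarith : 0 ≤ |(m : ℝ)|) (by nlinarith : 0 ≤ |(m : ℝ)| ^ 2 - 8)]
  simpa using this

/-- The operators `S₂ T₀` and `S₀² / 2` have the same principal part. -/
theorem hasOrder_S2_mul_T0_sub : HasOrder (-3) (S2 * T0 - (1 / 2 : ℂ) • (S0 * S0)) := by
  have hfc : ∀ u m, fc ((S2 * T0 - (1 / 2 : ℂ) • (S0 * S0)) u) m =
      (symS2 m * symT0 m - 1 / 2 * (symS0 m * symS0 m)) * fc u m := fun u m => by
    change fc (S2 (T0 u) - (1 / 2 : ℂ) • S0 (S0 u)) m = _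
    rw [fc_sub, fc_smul, fc_S2, fc_T0, fc_S0, fc_S0]
    ring
  have := hasOrder_neg_of_decay 3 zero_le_two 2 hfc fun m hm => by
    have hx : (3 : ℝ) ≤ |(m : ℝ)| := by exact_mod_cast (by omega : (3 : ℤ) ≤ |m|)
    have h4 : 0 < |(m : ℝ)| ^ 2 - 4 := by nlinarith
    have hm0 : m ≠ 0 := abs_pos.1 (by omega)
    have e : symS2 m * symT0 m - 1 / 2 * (symS0 m * symS0 m) =
        ((2 / (|(m : ℝ)| ^ 2 * (|(m : ℝ)| ^ 2 - 4)) : ℝ) : ℂ) := by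
      rw [symS2_eq hm, symT0_of_ne_zero hm0, symS0_of_ne_zero hm0]
      -- The leading terms 1/(2m²) cancel, leaving decay like 2|m|⁻⁴, more than order -3 requires.
      have h5 : -(1 / (2 * |(m : ℝ)| * (|(m : ℝ)| ^ 2 - 4))) * -|(m : ℝ)| -
          1 / 2 * (|(m : ℝ)|⁻¹ * |(m : ℝ)|⁻¹) = 2 / (|(m : ℝ)| ^ 2 * (|(m : ℝ)| ^ 2 - 4)) := by
        have : |(m : ℝ)| ≠ 0 := by positivity
        field_simp
        ring
      rw [← h5]
      push_cast
      ring
    rw [e, Complex.norm_real, Real.norm_of_nonneg (by positivity), div_mul_eq_mul_div,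
      div_le_iff₀ (by positivity)]
    -- The bound reduces to |m| ≤ |m|² - 4, which holds from |m| = 3 on.
    nlinarith [mul_nonneg (sq_nonneg |(m : ℝ)|) (by nlinarith : 0 ≤ |(m : ℝ)| ^ 2 - 4 - |(m : ℝ)|)]
  simpa using this

theorem hasOrder_smul_mulD (c : ℂ) (a : Test) : HasOrder 0 (c • mulD a) := (hasOrder_mulD a).smul c

theorem hasOrder_T0_commutator (c : ℂ) (a : Test) :
    HasOrder 0 (T0 * (c • mulD a) - (c • mulD a) * T0) := by
  rw [mul_smul_comm, smul_mul_assoc, ← smul_sub]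
  exact (hasOrder_commutator a).smul c

/-- Since S₀ = -T₀⁻¹, the commutator rule for inverses gives [S₀, M] = S₀[T₀, M]S₀, of order -1 + 0
- 1. -/
theorem hasOrder_S0_commutator (c : ℂ) (a : Test) :
    HasOrder (-2) (S0 * (c • mulD a) - (c • mulD a) * S0) := by
  have h : S0 * (c • mulD a) - (c • mulD a) * S0 =
      S0 * (T0 * (c • mulD a) - (c • mulD a) * T0) * S0 := by
    generalize c • mulD a = M
    have : S0 * (T0 * M - M * T0) * S0 = (S0 * T0) * M * S0 - S0 * M * (T0 * S0) := by
      noncomm_ring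
    rw [this, S0_mul_T0, T0_mul_S0]
    noncomm_ring
  rw [h]
  exact ((hasOrder_S0.mul (hasOrder_T0_commutator c a)).mul hasOrder_S0).mono (by norm_num)

/-! ## The square of the operator matrix -/

theorem opMatrix_mul (a b c d a' b' c' d' : Module.End ℂ Dist) :
    opMatrix a b c d * opMatrix a' b' c' d' =
      opMatrix (a * a' + b * c') (a * b' + b * d') (c * a' + d * c') (c * b' + d * d') := by
  refine LinearMap.ext fun ψ => ?_
  simp only [Module.End.mul_apply, opMatrix_apply, LinearMap.add_apply, map_add]
  exact Prod.ext (add_add_add_comm _ _ _ _) (add_add_add_comm _ _ _ _)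

theorem opMatrix_add (a b c d a' b' c' d' : Module.End ℂ Dist) :
    opMatrix a b c d + opMatrix a' b' c' d' =
      opMatrix (a + a') (b + b') (c + c') (d + d') := by
  refine LinearMap.ext fun ψ => ?_
  simp only [LinearMap.add_apply, opMatrix_apply, Prod.mk_add_mk]
  exact Prod.ext (add_add_add_comm _ _ _ _) (add_add_add_comm _ _ _ _)

/-! ### Ring identities for the diagonal entries of the square. -/

section Algebra

variable {R : Type*} [Ring R] {s0 t0 s2 e1 y x q k : R}

/-- Here x = E₂S₂, y = E₁/2, z = E₃S₁ + E₆S₂, q = S₀²/2 and k = S₂T₀ - S₀²/2. The unit cancels s0 *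
t0, and e1 * s0 * s0 comes half from e1 * s2 * t0 and half from s0 * y * s0 after commuting s0 past
y. Every term left on the right will have order -3. -/
theorem sq_entry_one_one (h1 : s0 * t0 = -1) (h2 : s2 * t0 = k + q) (h3 : e1 * q = y * (s0 * s0))
    (h4 : e1 = y + y) (z : R) :
    (1 + x) * (1 + x) + (s0 + e1 * s2) * (t0 + (y * s0 + z)) - e1 * s0 * s0 =
      x + x + x * x + (s0 * y - y * s0) * s0 + e1 * k + s0 * z + e1 * s2 * (y * s0 + z) := by
  have : (1 + x) * (1 + x) + (s0 + e1 * s2) * (t0 + (y * s0 + z)) =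
      1 + x + x + x * x + s0 * t0 + e1 * (s2 * t0) + s0 * y * s0 + s0 * z +
        e1 * s2 * (y * s0 + z) := by noncomm_ring
  rw [this, h1, h2, mul_add, h3]
  have h5 : e1 * s0 * s0 = y * s0 * s0 + y * s0 * s0 := by rw [h4]; noncomm_ring
  rw [h5]
  noncomm_ring

/-- With the factors in the other order, t0 must be moved past e1 instead of s0 past y, so the
commutator with t0 appears. -/
theorem sq_entry_two_two (h1 : t0 * s0 = -1) (h2 : t0 * s2 = k + q) (h3 : e1 * q = y * (s0 * s0))
    (h4 : e1 = y + y) (z : R) :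
    (t0 + (y * s0 + z)) * (s0 + e1 * s2) + (1 + x) * (1 + x) - e1 * s0 * s0 =
      x + x + x * x + (t0 * e1 - e1 * t0) * s2 + e1 * k + z * s0 + (y * s0 + z) * (e1 * s2) := by
  have : (t0 + (y * s0 + z)) * (s0 + e1 * s2) + (1 + x) * (1 + x) =
      1 + x + x + x * x + t0 * s0 + (t0 * e1 - e1 * t0) * s2 + e1 * (t0 * s2) + y * s0 * s0 +
        z * s0 + (y * s0 + z) * (e1 * s2) := by noncomm_ring
  rw [this, h1, h2, mul_add, h3]
  have h5 : e1 * s0 * s0 = y * s0 * s0 + y * s0 * s0 := by rw [h4]; noncomm_ring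
  rw [h5]
  noncomm_ring

end Algebra

/-! ### The inverse of the multiplication operator E₁. -/

namespace AnalyticCurve

variable (γ : AnalyticCurve) (κ : ℝ)

theorem speedSq_ne_zero (t : ℝ) : γ.speedSq t ≠ 0 := by
  have h : γ.d 1 t ≠ 0 := by
    rw [d, iteratedDeriv_one]; exact γ.regular t
  change ((‖γ.d 1 t‖ ^ 2 : ℝ) : ℂ) ≠ 0
  exact Complex.ofReal_ne_zero.2 (by positivity)

/-- The function `|γ'|⁻²`. -/
def speedSqInv : Test :=
  Test.mk (fun t => (γ.speedSq t)⁻¹) (γ.speedSq.smooth.inv γ.speedSq_ne_zero)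
    fun t => by simp only [γ.speedSq.periodic t]

/-- The inverse of `E₁`. -/
def E1Inv : Module.End ℂ Dist := ((κ ^ 2 : ℂ)⁻¹) • mulD γ.speedSqInv

theorem mulD_speedSq_mul_inv : mulD γ.speedSq * mulD γ.speedSqInv = 1 := by
  refine LinearMap.ext fun u => ContinuousLinearMap.ext fun φ => ?_
  change u (mulTest γ.speedSqInv (mulTest γ.speedSq φ)) = u φ
  congr 1
  ext t
  exact inv_mul_cancel_left₀ (γ.speedSq_ne_zero t) _

theorem mulD_speedSqInv_mul : mulD γ.speedSqInv * mulD γ.speedSq = 1 := by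
  refine LinearMap.ext fun u => ContinuousLinearMap.ext fun φ => ?_
  change u (mulTest γ.speedSq (mulTest γ.speedSqInv φ)) = u φ
  congr 1
  ext t
  exact mul_inv_cancel_left₀ (γ.speedSq_ne_zero t) _

variable {κ}

theorem E1_mul_E1Inv (hκ : κ ≠ 0) : γ.E1 κ * γ.E1Inv κ = 1 := by
  have : (κ ^ 2 : ℂ) ≠ 0 := pow_ne_zero 2 (Complex.ofReal_ne_zero.2 hκ)
  rw [E1, E1Inv, smul_mul_smul_comm, mulD_speedSq_mul_inv, mul_inv_cancel₀ this, one_smul]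

theorem E1Inv_mul_E1 (hκ : κ ≠ 0) : γ.E1Inv κ * γ.E1 κ = 1 := by
  have : (κ ^ 2 : ℂ) ≠ 0 := pow_ne_zero 2 (Complex.ofReal_ne_zero.2 hκ)
  rw [E1, E1Inv, smul_mul_smul_comm, mulD_speedSqInv_mul, inv_mul_cancel₀ this, one_smul]

variable (κ)

theorem hasOrder_E6 : HasOrder 0 (γ.E6 κ) := by
  have h2 : HasOrder 0 (mulD γ.speedSq ^ 2) := by
    rw [sq]
    exact ((hasOrder_mulD _).mul (hasOrder_mulD _)).mono (by norm_num)
  exact ((h2.smul _).add (hasOrder_smul_mulD _ _)).sub ((h2.smul _).add (hasOrder_smul_mulD _ _))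

end AnalyticCurve

/-- The identity cancels against S₀T₀ and T₀S₀, so both diagonal entries are E₁S₀², an operator of
order exactly -2. -/
theorem opU_eq (γ : AnalyticCurve) (κ : ℝ) :
    opU γ κ = opMatrix (γ.E1 κ * S0 * S0) 0 0 (γ.E1 κ * S0 * S0) := by
  rw [opU, S0_mul_T0, T0_mul_S0, add_neg_cancel, zero_add]

/-- The square of `N` is `U` up to operators of order `-3`. -/
theorem exists_opN_sq_eq (γ : AnalyticCurve) (κ : ℝ) : ∃ a b c d : Module.End ℂ Dist,
    HasOrder (-3) a ∧ HasOrder (-3) b ∧ HasOrder (-3) c ∧ HasOrder (-3) d ∧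
      opN γ κ ^ 2 = opU γ κ + opMatrix a b c d := by
  set E1 := γ.E1 κ with hE1
  -- This is E₁/2, written with a single scalar so that the lemmas for c • `mulD` a apply to it.
  set Y := ((1 / 2 : ℂ) * κ ^ 2) • mulD γ.speedSq with hY
  set X := γ.E2 κ * S2 with hX
  set Z := γ.E3 κ * S1 + γ.E6 κ * S2 with hZ
  set K := S2 * T0 - (1 / 2 : ℂ) • (S0 * S0) with hK
  have hYE : Y = (1 / 2 : ℂ) • E1 := by rw [hY, mul_smul]; rfl
  have hEY : E1 = Y + Y := by
    rw [hYE, ← add_smul]; norm_num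
  have hq : E1 * ((1 / 2 : ℂ) • (S0 * S0)) = Y * (S0 * S0) := by
    rw [hYE, mul_smul_comm, smul_mul_assoc]
  have hk : S2 * T0 = K + (1 / 2 : ℂ) • (S0 * S0) := (sub_add_cancel _ _).symm
  have oE1 : HasOrder 0 E1 := hasOrder_smul_mulD _ _
  have oY : HasOrder 0 Y := hasOrder_smul_mulD _ _
  have oE2 : HasOrder 0 (γ.E2 κ) := hasOrder_smul_mulD _ _
  have oX : HasOrder (-3) X := (oE2.mul hasOrder_S2).mono (by norm_num)
  have oK : HasOrder (-3) K := hasOrder_S2_mul_T0_sub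
  have oZ : HasOrder (-2) Z :=
    (((hasOrder_smul_mulD _ _).mul hasOrder_S1).mono (by norm_num)).add
      (((γ.hasOrder_E6 κ).mul hasOrder_S2).mono (by norm_num))
  have oQ : HasOrder (-1) (Y * S0 + Z) :=
    ((oY.mul hasOrder_S0).mono (by norm_num)).add (oZ.mono (by norm_num))
  have oES : HasOrder (-3) (E1 * S2) := (oE1.mul hasOrder_S2).mono (by norm_num)
  have oB : HasOrder (-1) (S0 + E1 * S2) := hasOrder_S0.add (oES.mono (by norm_num))
  have oEK : HasOrder (-3) (E1 * K) := (oE1.mul oK).mono (by norm_num)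
  have oXX : HasOrder (-3) (X + X + X * X) := (oX.add oX).add ((oX.mul oX).mono (by norm_num))
  have hN : opN γ κ = opMatrix (1 + X) (S0 + E1 * S2) (T0 + (Y * S0 + Z)) (-1 + -X) := by
    rw [opN, opMatrix_add, zero_add, hYE, smul_mul_assoc, hZ, add_assoc ((1 / 2 : ℂ) • _)]
  -- The diagonal entries of 𝒩 are opposite, so their squares agree and the off-diagonal entries of
  -- 𝒩² are commutators with X.
  have hA : (-1 + -X) * (-1 + -X) = (1 + X) * (1 + X) := by noncomm_ring
  refine ⟨X + X + X * X + (S0 * Y - Y * S0) * S0 + E1 * K + S0 * Z + E1 * S2 * (Y * S0 + Z),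
    X * (S0 + E1 * S2) - (S0 + E1 * S2) * X,
    (T0 * γ.E2 κ - γ.E2 κ * T0) * S2 + ((Y * S0 + Z) * X - X * (Y * S0 + Z)),
    X + X + X * X + (T0 * E1 - E1 * T0) * S2 + E1 * K + Z * S0 + (Y * S0 + Z) * (E1 * S2),
    ?_, ?_, ?_, ?_, ?_⟩
  · exact (((oXX.add (((hasOrder_S0_commutator _ _).mul hasOrder_S0).mono (by norm_num))).add
      oEK).add ((hasOrder_S0.mul oZ).mono (by norm_num))).add ((oES.mul oQ).mono (by norm_num))
  · exact ((oX.mul oB).mono (by norm_num)).sub ((oB.mul oX).mono (by norm_num))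
  · exact (((hasOrder_T0_commutator _ _).mul hasOrder_S2).mono (by norm_num)).add
      (((oQ.mul oX).mono (by norm_num)).sub ((oX.mul oQ).mono (by norm_num)))
  · exact (((oXX.add (((hasOrder_T0_commutator _ _).mul hasOrder_S2).mono (by norm_num))).add
      oEK).add ((oZ.mul hasOrder_S0).mono (by norm_num))).add ((oQ.mul oES).mono (by norm_num))
  · rw [hN, opU_eq, sq, opMatrix_mul, opMatrix_add, hA,
      ← sq_entry_one_one S0_mul_T0 hk hq hEY Z,
      ← sq_entry_two_two T0_mul_S0 (T0_mul_S2.trans hk) hq hEY Z, add_sub_cancel,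
      add_sub_cancel, zero_add, zero_add]
    congr 1
    · noncomm_ring
    · have : (T0 + (Y * S0 + Z)) * (1 + X) + (-1 + -X) * (T0 + (Y * S0 + Z)) =
          T0 * X - X * T0 + ((Y * S0 + Z) * X - X * (Y * S0 + Z)) := by noncomm_ring
      -- T₀X alone has only order -2. As T₀ commutes with S₂, [T₀, E₂S₂] = [T₀, E₂]S₂, which has
      -- order -3.
      rw [this, hX, mul_assoc (γ.E2 κ) S2 T0, ← T0_mul_S2]
      noncomm_ring

/-! ### Invertibility of 𝒰 and the conclusion. -/

/-- As S₀⁻¹ = -T₀, the inverse of E₁S₀² is T₀²E₁⁻¹, the two signs cancelling. The orders -2 and 2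
make both maps bounded between the right spaces. -/
theorem exists_equiv (γ : AnalyticCurve) {κ : ℝ} (hκ : κ ≠ 0) (s : ℝ) :
    ∃ e : Sobolev s ≃L[ℂ] Sobolev (s + 2),
      ∀ u, toDist (s + 2) (e u) = (γ.E1 κ * S0 * S0) (toDist s u) := by
  have o1 : HasOrder (-2) (γ.E1 κ * S0 * S0) :=
    (((hasOrder_smul_mulD _ _).mul hasOrder_S0).mul hasOrder_S0).mono (by norm_num)
  have o2 : HasOrder 2 (T0 * T0 * γ.E1Inv κ) :=
    ((hasOrder_T0.mul hasOrder_T0).mul (hasOrder_smul_mulD _ _)).mono (by norm_num)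
  have h12 : (γ.E1 κ * S0 * S0) * (T0 * T0 * γ.E1Inv κ) = 1 := by
    have : (γ.E1 κ * S0 * S0) * (T0 * T0 * γ.E1Inv κ) =
        γ.E1 κ * (S0 * (S0 * T0) * T0) * γ.E1Inv κ := by noncomm_ring
    rw [this, S0_mul_T0, mul_neg_one, neg_mul, S0_mul_T0, neg_neg, mul_one, γ.E1_mul_E1Inv hκ]
  have h21 : (T0 * T0 * γ.E1Inv κ) * (γ.E1 κ * S0 * S0) = 1 := by
    have : (T0 * T0 * γ.E1Inv κ) * (γ.E1 κ * S0 * S0) =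
        T0 * T0 * (γ.E1Inv κ * γ.E1 κ) * S0 * S0 := by noncomm_ring
    rw [this, γ.E1Inv_mul_E1 hκ, mul_one, mul_assoc T0, T0_mul_S0, mul_neg_one, neg_mul,
      T0_mul_S0, neg_neg]
  obtain ⟨L, hL⟩ := o1 s (s + 2) (by linarith)
  obtain ⟨K, hK⟩ := o2 (s + 2) s le_rfl
  refine ⟨ContinuousLinearEquiv.equivOfInverse L K (fun u => toDist_injective _ ?_)
    (fun u => toDist_injective _ ?_), hL⟩
  · rw [hK, hL, ← Module.End.mul_apply, h21, Module.End.one_apply]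
  · rw [hL, hK, ← Module.End.mul_apply, h12, Module.End.one_apply]

end Biharmonic

open Biharmonic in
theorem theorem3p2 (γ : AnalyticCurve) (κ : ℝ) (hκ : 0 < κ) (p : ℝ) (hp : 0 ≤ p) :
    ∃ (U : (Sobolev p × Sobolev p) ≃L[ℂ] (Sobolev (p + 2) × Sobolev (p + 2)))
      (J : (Sobolev p × Sobolev p) →L[ℂ] (Sobolev (p + 2) × Sobolev (p + 2))),
      (∀ ψ, toDist2 (p + 2) (U ψ) = opU γ κ (toDist2 p ψ)) ∧
      IsCompactOperator J ∧
      ∀ ψ, (opN γ κ ^ 2) (toDist2 p ψ) = toDist2 (p + 2) (U ψ + J ψ) := by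
  obtain ⟨a, b, c, d, ha, hb, hc, hd, hN⟩ := exists_opN_sq_eq γ κ
  obtain ⟨e, he⟩ := exists_equiv γ hκ.ne' p
  -- Order -3 gains three derivatives and the target asks for two; the spare one gives compactness.
  obtain ⟨A, hA, cA⟩ := ha.exists_compact_lift (s := p) (t := p + 2) (by linarith)
  obtain ⟨B, hB, cB⟩ := hb.exists_compact_lift (s := p) (t := p + 2) (by linarith)
  obtain ⟨C, hC, cC⟩ := hc.exists_compact_lift (s := p) (t := p + 2) (by linarith)
  obtain ⟨E, hE, cE⟩ := hd.exists_compact_lift (s := p) (t := p + 2) (by linarith)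
  have hU : ∀ ψ, toDist2 (p + 2) ((e.prodCongr e) ψ) = opU γ κ (toDist2 p ψ) := fun ψ => by
    rw [opU_eq, opMatrix_apply]
    simp only [LinearMap.zero_apply, add_zero, zero_add]
    exact Prod.ext (he ψ.1) (he ψ.2)
  let ι₁ := ContinuousLinearMap.inl ℂ (Sobolev (p + 2)) (Sobolev (p + 2))
  let ι₂ := ContinuousLinearMap.inr ℂ (Sobolev (p + 2)) (Sobolev (p + 2))
  let π₁ := ContinuousLinearMap.fst ℂ (Sobolev p) (Sobolev p)
  let π₂ := ContinuousLinearMap.snd ℂ (Sobolev p) (Sobolev p)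
  refine ⟨e.prodCongr e, (ι₁.comp (A.comp π₁) + ι₁.comp (B.comp π₂)) +
    (ι₂.comp (C.comp π₁) + ι₂.comp (E.comp π₂)), hU, ?_, fun ψ => ?_⟩
  · exact (((cA.comp_clm π₁).clm_comp ι₁).add ((cB.comp_clm π₂).clm_comp ι₁)).add
      (((cC.comp_clm π₁).clm_comp ι₂).add ((cE.comp_clm π₂).clm_comp ι₂))
  · rw [map_add, hU, hN, LinearMap.add_apply]
    congr 1
    rw [opMatrix_apply]
    -- The zero summands are the components that the injections `ι₁` and `ι₂` leave empty.
    change (a (toDist p ψ.1) + b (toDist p ψ.2), c (toDist p ψ.1) + d (toDist p ψ.2)) =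
      (toDist (p + 2) ((A ψ.1 + B ψ.2) + (0 + 0)), toDist (p + 2) ((0 + 0) + (C ψ.1 + E ψ.2)))
    simp only [add_zero, zero_add, map_add, hA, hB, hC, hE]
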